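/- Let $K\ge 2$, let $q_0\in\mathbb R^K$ have positive entries with sum $1$, and let $C_0\in(0,1)^{K\times K}$ be an invertible matrix whose columns sum to $1$. **Data.** For sample sizes $n^S_1,\dots,n^S_K,n'\in\mathbb N$ with $N=n'+\sum_i n^S_i$, the data consist of independent count vectors $\mathbf n^S_i\sim\mathrm{Multi}(n^S_i,(C_0)_{:,i})$ for $i=1,\dots,K$ and $\tilde{\mathbf n}\sim\mathrm{Multi}(n',C_0q_0)$. Their joint law is denoted by $\mathbb P_{(q_0,C_0)}$. **Label graph.** $W\in[0,1]^{K\times K}$ is a symmetric weight matrix whose graph (distinct $i,j$ are adjacent iff $W_{ij}\neq0$) is connected. $L=D-W$, with $D$ diagonal and $D_{ii}=\sum_jW_{ij}$, is its Laplacian, and $\lambda_2(L)$ is the smallest positive eigenvalue of $L$. **Prior.** On $\mathcal H=\{v\in\mathbb R^K:\sum_iv_i=0\}$ let $\mathcal N(0,(\tau L)^\dagger)$ be the Gaussian law with Lebesgue density proportional to $\exp(-\tfrac{\tau}{2}v^\top Lv)$. Independently, $\tau_q$ is either a fixed positive number or $\mathrm{Gamma}(a_q,b_q)$ distributed, and $\tau_C\sim\mathrm{Gamma}(a_C,b_C)$,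 where $a_q,b_q,a_C,b_C>0$. Given $(\tau_q,\tau_C)$, the vectors $\theta\sim\mathcal N(0,(\tau_qL)^\dagger)$ and $\phi_1,\dots,\phi_K\sim\mathcal N(0,(\tau_CL)^\dagger)$ are independent. Put $q=\mathrm{softmax}(\theta)$ and $C_{:,i}=\mathrm{softmax}(\phi_i)$. The posterior $\Pi(\cdot\mid\text{data})$ is obtained by Bayes' rule from this prior and the likelihood $\prod_i\mathrm{Multi}(\mathbf n_i^S;n_i^S,C_{:,i})\cdot\mathrm{Multi}(\tilde{\mathbf n};n',Cq)$, and $\mathrm{Var}_N(q_i)$ is the variance of $q_i$ under it. **Claim.** There is a constant $C>0$, depending only on $(q_0,C_0)$ and $K$, such that the following holds for every such $W$, every such choice of the prior of $\tau_q$, all $a_C,b_C>0$ and every $\rho>0$. For every $\delta>0$ there is $N_0$ such that for all sample sizes with $N\ge N_0$, $n'\ge\rho N$ and $n_i^S\ge\rho N$ for all $i$, with $\mathbb P_{(q_0,C_0)}$-probability at least $1-\delta$ the posterior is a well-defined probability measure and $$\mathrm{Var}_N(q_i)\le\frac{C}{\rho\,\lambda_2(L)\,N}\qquad\text{for all } i\in\{1,\dots,K\}.$$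 In particular, when all sample sizes are at least a fixed fraction of $N$, the bound $O\big(1/(\lambda_2(L)N)\big)$ holds with probability tending to one as $N\to\infty$. -/

import Mathlib

open MeasureTheory ProbabilityTheory

namespace GSBBSE

noncomputable section

/-! ### Multinomial likelihood -/

/-- The probability of the count vector `k` under the multinomial law with `n` trials and cell
probabilities `p`. -/
def multinomialProb {K : ℕ} (n : ℕ) (p : Fin K → ℝ) (k : Fin K → ℕ) : ℝ :=
  if ∑ j, k j = n then (Nat.multinomial Finset.univ k : ℝ) * ∏ j, p j ^ k j else 0

/-- A data set: `d.1 i j` is the number of source points of true class `i` that the classifier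
labels `j`, and `d.2 j` is the number of target points that the classifier labels `j`. -/
abbrev Data (K : ℕ) : Type := (Fin K → Fin K → ℕ) × (Fin K → ℕ)

/-- The complete-data likelihood of `(q, C)`: for each class `i` the source counts are
multinomial with `nS i` trials and cell probabilities the `i`-th column of `C`, the target counts
are multinomial with `nT` trials and cell probabilities `C q`, all of them independent. -/
def likelihood {K : ℕ} (nS : Fin K → ℕ) (nT : ℕ) (q : Fin K → ℝ)
    (C : Matrix (Fin K) (Fin K) ℝ) (d : Data K) : ℝ :=
  (∏ i, multinomialProb (nS i) (fun j => C j i) (d.1 i)) *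
    multinomialProb nT (Matrix.mulVec C q) d.2

/-- The sampling law of the data under the parameter `(q, C)`. -/
def dataLaw {K : ℕ} (nS : Fin K → ℕ) (nT : ℕ) (q : Fin K → ℝ)
    (C : Matrix (Fin K) (Fin K) ℝ) : Measure (Data K) :=
  Measure.count.withDensity fun d => ENNReal.ofReal (likelihood nS nT q C d)

/-! ### The label graph -/

/-- The unnormalised graph Laplacian `D - W` of a weight matrix `W`. -/
def laplacian {K : ℕ} (W : Matrix (Fin K) (Fin K) ℝ) : Matrix (Fin K) (Fin K) ℝ :=
  Matrix.diagonal (fun i => ∑ j, W i j) - W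

/-- `W` is the weight matrix of a connected undirected similarity graph on the labels, with
weights in `[0, 1]`; two distinct labels are joined by an edge when their weight is non-zero. -/
structure IsConnectedLabelGraph {K : ℕ} (W : Matrix (Fin K) (Fin K) ℝ) : Prop where
  symm : W.IsSymm
  nonneg : ∀ i j, 0 ≤ W i j
  le_one : ∀ i j, W i j ≤ 1
  connected : (SimpleGraph.fromRel fun i j => W i j ≠ 0).Connected

/-- The algebraic connectivity: the smallest positive eigenvalue of `L`. -/
def lambda2 {K : ℕ} (L : Matrix (Fin K) (Fin K) ℝ) : ℝ :=
  sInf {l : ℝ | 0 < l ∧ Module.End.HasEigenvalue (Matrix.toLin' L) l}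

/-! ### The hierarchical prior -/

/-- The space of centred log-odds vectors. -/
def centred (K : ℕ) : Submodule ℝ (EuclideanSpace ℝ (Fin K)) where
  carrier := {v | ∑ i, v i = 0}
  add_mem' := by
    intro a b ha hb
    simp only [Set.mem_ofPred_eq] at ha hb ⊢
    simp [Finset.sum_add_distrib, ha, hb]
  zero_mem' := by simp
  smul_mem' := by
    intro c a ha
    simp only [Set.mem_ofPred_eq] at ha ⊢
    simp [← Finset.mul_sum, ha]

/-- Lebesgue measure on the `(K - 1)`-dimensional Euclidean space of centred vectors. -/
def centredLebesgue (K : ℕ) : Measure (centred K) :=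
  (stdOrthonormalBasis ℝ (centred K)).toBasis.addHaar

/-- The softmax map. -/
def softmax {K : ℕ} (v : EuclideanSpace ℝ (Fin K)) (i : Fin K) : ℝ :=
  Real.exp (v i) / ∑ j, Real.exp (v j)

/-- `exp (-(τ / 2) vᵀ L v)`. -/
def gmrfWeight {K : ℕ} (L : Matrix (Fin K) (Fin K) ℝ) (τ : ℝ) (v : centred K) : ENNReal :=
  ENNReal.ofReal (Real.exp (-(τ / 2) *
    ∑ i, ∑ j, (v : EuclideanSpace ℝ (Fin K)) i * L i j * (v : EuclideanSpace ℝ (Fin K)) j))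

/-- The density, with respect to Lebesgue measure on the centred vectors, of the Gaussian Markov
random field with precision `τ L`, i.e. of the centred Gaussian law with covariance the
pseudo-inverse of `τ L`. -/
def gmrfDensity {K : ℕ} (L : Matrix (Fin K) (Fin K) ℝ) (τ : ℝ) (v : centred K) : ENNReal :=
  gmrfWeight L τ v / ∫⁻ w, gmrfWeight L τ w ∂(centredLebesgue K)

/-- The parameters `((τ_q, θ), (τ_C, φ))` of the hierarchy: `θ` is the log-odds vector of the
target class prior and `φ i` that of the `i`-th column of the confusion matrix. -/
abbrev Param (K : ℕ) : Type := (ℝ × centred K) × (ℝ × (Fin K → centred K))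

/-- The target class prior `q = softmax θ`. -/
def Param.q {K : ℕ} (x : Param K) : Fin K → ℝ :=
  softmax (x.1.2 : EuclideanSpace ℝ (Fin K))

/-- The confusion matrix, with `i`-th column `softmax (φ i)`. -/
def Param.conf {K : ℕ} (x : Param K) : Matrix (Fin K) (Fin K) ℝ :=
  Matrix.of fun j i => softmax (x.2.2 i : EuclideanSpace ℝ (Fin K)) j

/-- The joint prior: `τ_q ∼ πq` and `τ_C ∼ πC` are independent; given them, `θ` is a Gaussian
Markov random field with precision `τ_q L`, the `φ i` are Gaussian Markov random fields with
precision `τ_C L`, and all these are independent. -/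
def prior {K : ℕ} (L : Matrix (Fin K) (Fin K) ℝ) (πq πC : Measure ℝ) : Measure (Param K) :=
  ((πq.prod (centredLebesgue K)).prod
      (πC.prod (Measure.pi fun _ : Fin K => centredLebesgue K))).withDensity
    fun x => gmrfDensity L x.1.1 x.1.2 * ∏ i, gmrfDensity L x.2.1 (x.2.2 i)

/-- The prior reweighted by the likelihood of the data. -/
def unnormalizedPosterior {K : ℕ} (L : Matrix (Fin K) (Fin K) ℝ) (πq πC : Measure ℝ)
    (nS : Fin K → ℕ) (nT : ℕ) (d : Data K) : Measure (Param K) :=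
  (prior L πq πC).withDensity fun x => ENNReal.ofReal (likelihood nS nT x.q x.conf d)

/-- The joint posterior (Bayes' rule). -/
def posterior {K : ℕ} (L : Matrix (Fin K) (Fin K) ℝ) (πq πC : Measure ℝ)
    (nS : Fin K → ℕ) (nT : ℕ) (d : Data K) : Measure (Param K) :=
  (unnormalizedPosterior L πq πC nS nT d Set.univ)⁻¹ • unnormalizedPosterior L πq πC nS nT d

/-- The posterior variance of the class prior `q i`. -/
def posteriorVar {K : ℕ} (L : Matrix (Fin K) (Fin K) ℝ) (πq πC : Measure ℝ)
    (nS : Fin K → ℕ) (nT : ℕ) (d : Data K) (i : Fin K) : ℝ :=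
  variance (fun x : Param K => x.q i) (posterior L πq πC nS nT d)

/-- The hyper-prior of `τ_q`: a fixed positive value, or a Gamma law. -/
def IsFixedOrGamma (π : Measure ℝ) : Prop :=
  (∃ τ : ℝ, 0 < τ ∧ π = Measure.dirac τ) ∨
    ∃ a b : ℝ, 0 < a ∧ 0 < b ∧ π = gammaMeasure a b

end

end GSBBSE

namespace GSBBSE

/-! ### Relative entropy of discrete distributions -/

/-- The relative entropy `∑ j, f j * log (f j / p j)`. -/
noncomputable def relEnt {ι : Type*} [Fintype ι] (f p : ι → ℝ) : ℝ :=
  ∑ j, f j * Real.log (f j / p j)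

section relEnt

variable {ι : Type*} [Fintype ι]

lemma sq_sub_le_mul_log_div {f p : ℝ} (hf : 0 < f) (hp : 0 < p) (hf1 : f ≤ 1) (hp1 : p ≤ 1) :
    (f - p) ^ 2 ≤ 4 * (f * Real.log (f / p) - f + p) := by
  have hsf := Real.sqrt_pos.2 hf
  have hsp := Real.sqrt_pos.2 hp
  set a := √f with ha
  set b := √p with hb
  have hfa : f = a ^ 2 := (Real.sq_sqrt hf.le).symm
  have hpb : p = b ^ 2 := (Real.sq_sqrt hp.le).symm
  have ha1 : a ≤ 1 := Real.sqrt_le_one.2 hf1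
  have hb1 : b ≤ 1 := Real.sqrt_le_one.2 hp1
  have hlog : Real.log (f / p) = -2 * Real.log (b / a) := by
    rw [hfa, hpb, ← div_pow, Real.log_pow, ← inv_div, Real.log_inv]
    push_cast
    ring
  have h1 : Real.log (b / a) ≤ b / a - 1 := Real.log_le_sub_one_of_pos (by positivity)
  have h2 : a ^ 2 * Real.log (b / a) ≤ a * b - a ^ 2 := by
    have := mul_le_mul_of_nonneg_left h1 (sq_nonneg a)
    calc _ ≤ _ := this
      _ = _ := by field_simp
  have h3 : (a - b) ^ 2 ≤ f * Real.log (f / p) - f + p := by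
    rw [hlog, hfa, hpb]
    nlinarith
  have h4 : (f - p) ^ 2 ≤ 4 * (a - b) ^ 2 := by
    rw [hfa, hpb]
    have : (a + b) ^ 2 ≤ 4 := by nlinarith
    nlinarith [sq_nonneg (a - b), mul_le_mul_of_nonneg_right this (sq_nonneg (a - b))]
  linarith

lemma sum_sq_sub_le_relEnt {f p : ι → ℝ} (hf : ∀ j, 0 < f j) (hp : ∀ j, 0 < p j)
    (hf1 : ∑ j, f j = 1) (hp1 : ∑ j, p j = 1) :
    ∑ j, (f j - p j) ^ 2 ≤ 4 * relEnt f p := by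
  have hle : ∀ g : ι → ℝ, (∀ j, 0 < g j) → ∑ j, g j = 1 → ∀ j, g j ≤ 1 := fun g hg hg1 j => by
    rw [← hg1]
    exact Finset.single_le_sum (fun i _ => (hg i).le) (Finset.mem_univ j)
  calc ∑ j, (f j - p j) ^ 2 ≤ ∑ j, 4 * (f j * Real.log (f j / p j) - f j + p j) :=
        Finset.sum_le_sum fun j _ =>
          sq_sub_le_mul_log_div (hf j) (hp j) (hle f hf hf1 j) (hle p hp hp1 j)
    _ = 4 * relEnt f p := by
        rw [← Finset.mul_sum, Finset.sum_add_distrib, Finset.sum_sub_distrib, hf1, hp1, relEnt]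
        ring

lemma relEnt_nonneg {f p : ι → ℝ} (hf : ∀ j, 0 < f j) (hp : ∀ j, 0 < p j)
    (hf1 : ∑ j, f j = 1) (hp1 : ∑ j, p j = 1) : 0 ≤ relEnt f p := by
  have := sum_sq_sub_le_relEnt hf hp hf1 hp1
  have h0 : 0 ≤ ∑ j, (f j - p j) ^ 2 := Finset.sum_nonneg fun j _ => sq_nonneg _
  linarith

lemma two_mul_relEnt_midpoint_le {f p w : ι → ℝ} (hf : ∀ j, 0 < f j) (hp : ∀ j, 0 < p j)
    (hw : ∀ j, 2 * w j = f j + p j) : 2 * relEnt f w ≤ relEnt f p := by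
  rw [relEnt, relEnt, Finset.mul_sum]
  refine Finset.sum_le_sum fun j _ => ?_
  have hwj : 0 < w j := by linarith [hw j, hf j, hp j]
  rw [Real.log_div (hf j).ne' hwj.ne', Real.log_div (hf j).ne' (hp j).ne']
  have h : Real.log (f j) + Real.log (p j) ≤ 2 * Real.log (w j) := by
    rw [← Real.log_mul (hf j).ne' (hp j).ne',
      show 2 * Real.log (w j) = Real.log (w j ^ 2) by rw [Real.log_pow]; norm_num]
    refine Real.log_le_log (mul_pos (hf j) (hp j)) ?_
    nlinarith [hw j, sq_nonneg (f j - p j)]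
  nlinarith [hf j]

lemma continuousAt_relEnt {f₀ p₀ : ι → ℝ} (hf : ∀ j, 0 < f₀ j) (hp : ∀ j, 0 < p₀ j) :
    ContinuousAt (fun x : (ι → ℝ) × (ι → ℝ) => relEnt x.1 x.2) (f₀, p₀) := by
  unfold relEnt
  refine tendsto_finsetSum _ fun j _ => ?_
  have h1 : ContinuousAt (fun x : (ι → ℝ) × (ι → ℝ) => x.1 j) (f₀, p₀) := by fun_prop
  have h2 : ContinuousAt (fun x : (ι → ℝ) × (ι → ℝ) => x.2 j) (f₀, p₀) := by fun_prop
  exact h1.mul ((h1.div h2 (hp j).ne').log (div_pos (hf j) (hp j)).ne')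

lemma measurable_relEnt (f : ι → ℝ) : Measurable fun p : ι → ℝ => relEnt f p := by
  unfold relEnt
  fun_prop

lemma relEnt_self {f : ι → ℝ} (hf : ∀ j, 0 < f j) : relEnt f f = 0 :=
  Finset.sum_eq_zero fun j _ => by rw [div_self (hf j).ne', Real.log_one, mul_zero]

end relEnt

/-! ### Multinomial probabilities -/

lemma multinomialProb_nonneg {K n : ℕ} {p : Fin K → ℝ} (hp : ∀ j, 0 ≤ p j) (k : Fin K → ℕ) :
    0 ≤ multinomialProb n p k := by
  unfold multinomialProb
  split_ifs
  · exact mul_nonneg (Nat.cast_nonneg _) (Finset.prod_nonneg fun j _ => pow_nonneg (hp j) _)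
  · exact le_rfl

lemma multinomialProb_eq_mul_exp_relEnt {K n : ℕ} {p f : Fin K → ℝ} {k : Fin K → ℕ}
    (hp : ∀ j, 0 < p j) (hf : ∀ j, 0 < f j) (hk : ∀ j, (k j : ℝ) = n * f j) :
    multinomialProb n p k = multinomialProb n f k * Real.exp (-(n * relEnt f p)) := by
  unfold multinomialProb
  split_ifs
  · rw [mul_assoc]
    congr 1
    rw [relEnt, Finset.mul_sum, ← Finset.sum_neg_distrib, Real.exp_sum, ← Finset.prod_mul_distrib]
    refine Finset.prod_congr rfl fun j _ => ?_
    rw [← mul_assoc, ← hk j, ← mul_neg, ← Real.log_inv, inv_div, Real.exp_nat_mul,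
      Real.exp_log (div_pos (hp j) (hf j)), ← mul_pow, mul_div_cancel₀ _ (hf j).ne']
  · simp

lemma sum_multinomialProb_mul_prod_pow {K : ℕ} (n : ℕ) (p s : Fin K → ℝ) :
    ∑ k ∈ Finset.piAntidiag Finset.univ n, multinomialProb n p k * ∏ j, s j ^ k j =
      (∑ j, p j * s j) ^ n := by
  rw [Finset.sum_pow_eq_sum_piAntidiag]
  refine Finset.sum_congr rfl fun k hk => ?_
  rw [multinomialProb, if_pos (Finset.mem_piAntidiag.1 hk).1, mul_assoc, ← Finset.prod_mul_distrib]
  simp only [mul_pow]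

/-! ### The cell probabilities of all samples -/

/-- The cell probabilities of the target sample (`none`) and of the source samples (`some i`). -/
noncomputable def cells {K : ℕ} (q : Fin K → ℝ) (C : Matrix (Fin K) (Fin K) ℝ) :
    Option (Fin K) → Fin K → ℝ
  | none => C.mulVec q
  | some i => fun j => C j i

/-- The sizes of all samples. -/
def sizes {K : ℕ} (nS : Fin K → ℕ) (nT : ℕ) : Option (Fin K) → ℕ
  | none => nT
  | some i => nS i

/-- The count vectors of all samples. -/
def counts {K : ℕ} (d : Data K) : Option (Fin K) → Fin K → ℕ
  | none => d.2
  | some i => d.1 i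

/-- The data sets with the prescribed sample sizes. -/
def dataSupport {K : ℕ} (nS : Fin K → ℕ) (nT : ℕ) : Finset (Data K) :=
  (Fintype.piFinset fun i => Finset.piAntidiag Finset.univ (nS i)) ×ˢ
    Finset.piAntidiag Finset.univ nT

section

variable {K : ℕ} {nS : Fin K → ℕ} {nT : ℕ} {q : Fin K → ℝ} {C : Matrix (Fin K) (Fin K) ℝ}

lemma mem_dataSupport {d : Data K} :
    d ∈ dataSupport nS nT ↔ ∀ o, ∑ j, counts d o j = sizes nS nT o := by
  simp [dataSupport, counts, sizes, Option.forall, and_comm]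

lemma likelihood_eq_prod (d : Data K) :
    likelihood nS nT q C d = ∏ o, multinomialProb (sizes nS nT o) (cells q C o) (counts d o) := by
  rw [Fintype.prod_option, likelihood, mul_comm]
  rfl

lemma likelihood_nonneg (hz : ∀ o j, 0 ≤ cells q C o j) (d : Data K) :
    0 ≤ likelihood nS nT q C d := by
  rw [likelihood_eq_prod]
  exact Finset.prod_nonneg fun o _ => multinomialProb_nonneg (hz o) _

lemma likelihood_eq_zero_of_notMem {d : Data K} (hd : d ∉ dataSupport nS nT) :
    likelihood nS nT q C d = 0 := by
  rw [mem_dataSupport, not_forall] at hd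
  obtain ⟨o, ho⟩ := hd
  rw [likelihood_eq_prod]
  exact Finset.prod_eq_zero (Finset.mem_univ o) (if_neg ho)

lemma sum_likelihood_mul_prod_pow (s : Option (Fin K) → Fin K → ℝ) :
    ∑ d ∈ dataSupport nS nT, likelihood nS nT q C d * ∏ o, ∏ j, s o j ^ counts d o j =
      ∏ o, (∑ j, cells q C o j * s o j) ^ sizes nS nT o := by
  have h (d : Data K) : likelihood nS nT q C d * ∏ o, ∏ j, s o j ^ counts d o j =
      (∏ i, multinomialProb (nS i) (cells q C (some i)) (d.1 i) *
        ∏ j, s (some i) j ^ d.1 i j) *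
      (multinomialProb nT (cells q C none) d.2 * ∏ j, s none j ^ d.2 j) := by
    rw [likelihood_eq_prod, ← Finset.prod_mul_distrib, Fintype.prod_option, mul_comm]
    rfl
  simp only [h]
  rw [Fintype.prod_option, dataSupport, Finset.sum_product]
  dsimp only [sizes]
  rw [← Finset.sum_mul_sum, sum_multinomialProb_mul_prod_pow, mul_comm]
  congr 1
  rw [← Finset.prod_univ_sum (fun i => Finset.piAntidiag Finset.univ (nS i))
    (fun i k => multinomialProb (nS i) (cells q C (some i)) k * ∏ j, s (some i) j ^ k j)]
  exact Finset.prod_congr rfl fun i _ => sum_multinomialProb_mul_prod_pow _ _ _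

lemma sum_likelihood (hz1 : ∀ o, ∑ j, cells q C o j = 1) :
    ∑ d ∈ dataSupport nS nT, likelihood nS nT q C d = 1 := by
  have h := sum_likelihood_mul_prod_pow (nS := nS) (nT := nT) (q := q) (C := C) fun _ _ => 1
  simpa [hz1] using h

lemma sum_likelihood_mul_exp_le (hz : ∀ o j, 0 ≤ cells q C o j)
    (hz1 : ∀ o, ∑ j, cells q C o j = 1) (o : Option (Fin K)) (j : Fin K) {u : ℝ}
    (hu : |u| ≤ 1) :
    ∑ d ∈ dataSupport nS nT, likelihood nS nT q C d *
        Real.exp (u * (counts d o j - sizes nS nT o * cells q C o j)) ≤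
      Real.exp (sizes nS nT o * u ^ 2) := by
  set n := sizes nS nT o
  set z := cells q C o j
  have hz0 : 0 ≤ z := hz o j
  have hzle : z ≤ 1 := by
    rw [← hz1 o]
    exact Finset.single_le_sum (fun i _ => hz o i) (Finset.mem_univ j)
  have h := sum_likelihood_mul_prod_pow (nS := nS) (nT := nT) (q := q) (C := C)
    fun o' j' => if o' = o ∧ j' = j then Real.exp u else 1
  have hl : ∀ d : Data K, (∏ o', ∏ j', (if o' = o ∧ j' = j then Real.exp u else 1) ^
      counts d o' j') = Real.exp (u * counts d o j) := fun d => by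
    rw [Finset.prod_eq_single o, Finset.prod_eq_single j]
    · rw [if_pos ⟨rfl, rfl⟩, ← Real.exp_nat_mul, mul_comm]
    · intro j' _ hj'
      simp [hj']
    · simp
    · intro o' _ ho'
      simp [ho']
    · simp
  have hr : (∏ o', (∑ j', cells q C o' j' * (if o' = o ∧ j' = j then Real.exp u else 1)) ^
      sizes nS nT o') = (1 + z * (Real.exp u - 1)) ^ n := by
    rw [Finset.prod_eq_single o]
    · congr 1
      have he (j' : Fin K) : cells q C o j' * (if o = o ∧ j' = j then Real.exp u else 1) =
          cells q C o j' + if j' = j then cells q C o j' * (Real.exp u - 1) else 0 := by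
        by_cases hj' : j' = j
        · simp only [hj', and_self, if_true]
          ring
        · simp [hj']
      rw [Finset.sum_congr rfl fun j' _ => he j', Finset.sum_add_distrib, hz1,
        Finset.sum_ite_eq' Finset.univ, if_pos (Finset.mem_univ j)]
    · intro o' _ ho'
      simp [ho', hz1]
    · simp
  simp only [hl, hr] at h
  have he : Real.exp u - 1 ≤ u + u ^ 2 := by
    have := (abs_le.1 (Real.abs_exp_sub_one_sub_id_le hu)).2
    linarith
  have h1 : 1 + z * (Real.exp u - 1) ≤ Real.exp (z * u + u ^ 2) := by
    have := Real.add_one_le_exp (z * u + u ^ 2)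
    nlinarith [mul_le_mul_of_nonneg_left he hz0, sq_nonneg u]
  have h0 : 0 ≤ 1 + z * (Real.exp u - 1) := by nlinarith [Real.exp_pos u]
  calc _ = (∑ d ∈ dataSupport nS nT, likelihood nS nT q C d * Real.exp (u * counts d o j)) *
        Real.exp (-(u * (n * z))) := by
        rw [Finset.sum_mul]
        refine Finset.sum_congr rfl fun d _ => ?_
        rw [mul_assoc, ← Real.exp_add]
        congr 2
        ring
    _ ≤ Real.exp (z * u + u ^ 2) ^ n * Real.exp (-(u * (n * z))) := by
        rw [h]
        gcongr
    _ = Real.exp (n * u ^ 2) := by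
        rw [← Real.exp_nat_mul, ← Real.exp_add]
        congr 1
        ring

lemma sum_likelihood_deviation_le (hz : ∀ o j, 0 ≤ cells q C o j)
    (hz1 : ∀ o, ∑ j, cells q C o j = 1) (o : Option (Fin K)) (j : Fin K) {ε : ℝ}
    (hε : 0 < ε) (hε1 : ε ≤ 1) :
    ∑ d ∈ dataSupport nS nT, likelihood nS nT q C d *
        (if ε * sizes nS nT o ≤ |counts d o j - sizes nS nT o * cells q C o j| then 1 else 0) ≤
      2 * Real.exp (-(sizes nS nT o * ε ^ 2 / 4)) := by
  set n := sizes nS nT o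
  set z := cells q C o j
  have hle : ∀ x : ℝ, (if ε * n ≤ |x| then (1 : ℝ) else 0) ≤
      (Real.exp (ε / 2 * x) + Real.exp (-(ε / 2) * x)) * Real.exp (-(n * ε ^ 2 / 2)) := by
    intro x
    split_ifs with hx
    · rw [add_mul, ← Real.exp_add, ← Real.exp_add]
      rcases le_abs.1 hx with hx | hx
      · have : 1 ≤ Real.exp (ε / 2 * x + -(n * ε ^ 2 / 2)) := Real.one_le_exp (by nlinarith)
        linarith [Real.exp_pos (-(ε / 2) * x + -(n * ε ^ 2 / 2))]
      · have : 1 ≤ Real.exp (-(ε / 2) * x + -(n * ε ^ 2 / 2)) := Real.one_le_exp (by nlinarith)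
        linarith [Real.exp_pos (ε / 2 * x + -(n * ε ^ 2 / 2))]
    · positivity
  have h1 := sum_likelihood_mul_exp_le (nS := nS) (nT := nT) hz hz1 o j (u := ε / 2)
    (by rw [abs_of_pos (by positivity)]; linarith)
  have h2 := sum_likelihood_mul_exp_le (nS := nS) (nT := nT) hz hz1 o j (u := -(ε / 2))
    (by rw [abs_neg, abs_of_pos (by positivity)]; linarith)
  rw [neg_sq] at h2
  calc _ ≤ ∑ d ∈ dataSupport nS nT, likelihood nS nT q C d *
        ((Real.exp (ε / 2 * (counts d o j - n * z)) + Real.exp (-(ε / 2) *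
          (counts d o j - n * z))) * Real.exp (-(n * ε ^ 2 / 2))) :=
        Finset.sum_le_sum fun d _ => mul_le_mul_of_nonneg_left (hle _) (likelihood_nonneg hz d)
    _ = (∑ d ∈ dataSupport nS nT, likelihood nS nT q C d *
          Real.exp (ε / 2 * (counts d o j - n * z)) +
        ∑ d ∈ dataSupport nS nT, likelihood nS nT q C d *
          Real.exp (-(ε / 2) * (counts d o j - n * z))) * Real.exp (-(n * ε ^ 2 / 2)) := by
        rw [← Finset.sum_add_distrib, Finset.sum_mul]
        refine Finset.sum_congr rfl fun d _ => ?_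
        ring
    _ ≤ (Real.exp (n * (ε / 2) ^ 2) + Real.exp (n * (ε / 2) ^ 2)) *
        Real.exp (-(n * ε ^ 2 / 2)) := by gcongr
    _ = 2 * Real.exp (-(n * ε ^ 2 / 4)) := by
        rw [← two_mul, mul_assoc, ← Real.exp_add]
        congr 2
        ring

lemma dataLaw_apply (s : Set (Data K)) [DecidablePred (· ∈ s)] :
    dataLaw nS nT q C s =
      ∑ d ∈ dataSupport nS nT with d ∈ s, ENNReal.ofReal (likelihood nS nT q C d) := by
  have hs : ∀ t : Set (Data K), MeasurableSet t := fun t => t.to_countable.measurableSet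
  rw [dataLaw, withDensity_apply _ (hs s), ← lintegral_indicator (hs s), lintegral_count,
    tsum_eq_sum (s := dataSupport nS nT), Finset.sum_filter]
  · exact Finset.sum_congr rfl fun d _ => by simp [Set.indicator_apply]
  · intro d hd
    simp [Set.indicator_apply, likelihood_eq_zero_of_notMem hd]

lemma dataLaw_real (hz : ∀ o j, 0 ≤ cells q C o j) (s : Set (Data K))
    [DecidablePred (· ∈ s)] : (dataLaw nS nT q C).real s =
      ∑ d ∈ dataSupport nS nT with d ∈ s, likelihood nS nT q C d := by
  rw [Measure.real, dataLaw_apply, ENNReal.toReal_sum (by simp)]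
  exact Finset.sum_congr rfl fun d _ => ENNReal.toReal_ofReal (likelihood_nonneg hz d)

/-- The law of large numbers for the empirical frequencies of all samples. -/
lemma dataLaw_real_frequencies_ge (hz : ∀ o j, 0 ≤ cells q C o j)
    (hz1 : ∀ o, ∑ j, cells q C o j = 1) {ε : ℝ} (hε : 0 < ε) (hε1 : ε ≤ 1) {m : ℝ}
    (hm : ∀ o, m ≤ sizes nS nT o) (s : Set (Data K))
    (hs : ∀ d, d ∈ dataSupport nS nT →
      (∀ o j, |counts d o j - sizes nS nT o * cells q C o j| < ε * sizes nS nT o) → d ∈ s) :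
    1 - (K + 1) * K * (2 * Real.exp (-(m * ε ^ 2 / 4))) ≤ (dataLaw nS nT q C).real s := by
  classical
  rw [dataLaw_real hz, Finset.sum_filter, sub_le_comm]
  calc _ = ∑ d ∈ dataSupport nS nT, (likelihood nS nT q C d -
        if d ∈ s then likelihood nS nT q C d else 0) := by
        rw [Finset.sum_sub_distrib, sum_likelihood hz1]
    _ ≤ ∑ d ∈ dataSupport nS nT, ∑ o, ∑ j, likelihood nS nT q C d *
        (if ε * sizes nS nT o ≤ |counts d o j - sizes nS nT o * cells q C o j|
          then 1 else 0) := by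
        refine Finset.sum_le_sum fun d hd => ?_
        have h0 : ∀ o j, 0 ≤ likelihood nS nT q C d *
          (if ε * sizes nS nT o ≤ |counts d o j - sizes nS nT o * cells q C o j|
            then (1 : ℝ) else 0) := fun o j => mul_nonneg (likelihood_nonneg hz d) (by positivity)
        split_ifs with hds
        · rw [sub_self]
          exact Finset.sum_nonneg fun o _ => Finset.sum_nonneg fun j _ => h0 o j
        · have := mt (hs d hd) hds
          push Not at this
          obtain ⟨o, j, hoj⟩ := this
          rw [sub_zero]
          refine le_trans ?_ (Finset.single_le_sum
            (fun o _ => Finset.sum_nonneg fun j _ => h0 o j) (Finset.mem_univ o))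
          refine le_trans ?_ (Finset.single_le_sum (fun j _ => h0 o j) (Finset.mem_univ j))
          rw [if_pos hoj, mul_one]
    _ = ∑ o, ∑ j, ∑ d ∈ dataSupport nS nT, likelihood nS nT q C d *
        (if ε * sizes nS nT o ≤ |counts d o j - sizes nS nT o * cells q C o j|
          then 1 else 0) := by
        rw [Finset.sum_comm]
        exact Finset.sum_congr rfl fun o _ => Finset.sum_comm
    _ ≤ ∑ _o : Option (Fin K), ∑ _j : Fin K, 2 * Real.exp (-(m * ε ^ 2 / 4)) := by
        refine Finset.sum_le_sum fun o _ => Finset.sum_le_sum fun j _ => ?_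
        refine (sum_likelihood_deviation_le hz hz1 o j hε hε1).trans ?_
        have := hm o
        gcongr
    _ = (K + 1) * K * (2 * Real.exp (-(m * ε ^ 2 / 4))) := by
        simp only [Finset.sum_const, Finset.card_univ, Fintype.card_option, Fintype.card_fin,
          nsmul_eq_mul]
        push_cast
        ring

end

/-! ### The softmax parametrisation -/

lemma softmax_pos {K : ℕ} (v : EuclideanSpace ℝ (Fin K)) (i : Fin K) : 0 < softmax v i :=
  div_pos (Real.exp_pos _) (Finset.sum_pos (fun _ _ => Real.exp_pos _) ⟨i, Finset.mem_univ i⟩)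

lemma sum_exp_pos {K : ℕ} [NeZero K] (v : EuclideanSpace ℝ (Fin K)) :
    0 < ∑ j, Real.exp (v j) :=
  Finset.sum_pos (fun _ _ => Real.exp_pos _) Finset.univ_nonempty

lemma sum_softmax {K : ℕ} [NeZero K] (v : EuclideanSpace ℝ (Fin K)) : ∑ i, softmax v i = 1 := by
  unfold softmax
  rw [← Finset.sum_div, div_self (sum_exp_pos v).ne']

lemma contDiff_softmax {K : ℕ} [NeZero K] :
    ContDiff ℝ 1 fun v : centred K => softmax (v : EuclideanSpace ℝ (Fin K)) := by
  rw [contDiff_pi]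
  intro i
  have h (j : Fin K) : ContDiff ℝ 1 fun v : centred K =>
      Real.exp ((v : EuclideanSpace ℝ (Fin K)) j) :=
    (((EuclideanSpace.proj j : EuclideanSpace ℝ (Fin K) →L[ℝ] ℝ).comp
      (centred K).subtypeL).contDiff).exp
  exact (h i).div (ContDiff.sum fun j _ => h j) fun v => (sum_exp_pos _).ne'

/-- The projection of `ℝ^K` to the centred vectors. -/
noncomputable def centre (K : ℕ) : (Fin K → ℝ) →ₗ[ℝ] centred K where
  toFun v := ⟨WithLp.toLp 2 fun i => v i - (∑ j, v j) / K, by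
    change ∑ i, (v i - (∑ j, v j) / K) = 0
    rcases Nat.eq_zero_or_pos K with rfl | hK
    · simp
    · rw [Finset.sum_sub_distrib, Finset.sum_const, Finset.card_univ, Fintype.card_fin,
        nsmul_eq_mul, mul_div_cancel₀ _ (Nat.cast_ne_zero.2 hK.ne'), sub_self]⟩
  map_add' v w := by
    ext i
    simp only [Pi.add_apply, Finset.sum_add_distrib, Submodule.coe_add, PiLp.add_apply]
    ring
  map_smul' c v := by
    ext i
    simp only [Pi.smul_apply, smul_eq_mul, ← Finset.mul_sum, RingHom.id_apply,
      Submodule.coe_smul, PiLp.smul_apply]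
    ring

lemma centre_apply {K : ℕ} (v : Fin K → ℝ) (i : Fin K) :
    (centre K v : EuclideanSpace ℝ (Fin K)) i = v i - (∑ j, v j) / K := rfl

/-- The centred log-odds of a probability vector. -/
noncomputable def centredLog {K : ℕ} (p : Fin K → ℝ) : centred K :=
  centre K fun i => Real.log (p i)

lemma softmax_centredLog {K : ℕ} {p : Fin K → ℝ} (hp : ∀ i, 0 < p i) (hp1 : ∑ i, p i = 1) :
    softmax (centredLog p : EuclideanSpace ℝ (Fin K)) = p := by
  ext i
  simp only [softmax, centredLog, centre_apply, Real.exp_sub, Real.exp_log (hp _)]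
  rw [← Finset.sum_div, hp1]
  field_simp

lemma centredLog_softmax {K : ℕ} [NeZero K] (v : centred K) :
    centredLog (softmax (v : EuclideanSpace ℝ (Fin K))) = v := by
  ext i
  have hv : ∑ j, (v : EuclideanSpace ℝ (Fin K)) j = 0 := v.2
  have hK : (K : ℝ) ≠ 0 := Nat.cast_ne_zero.2 (NeZero.ne K)
  simp only [centredLog, centre_apply, softmax, Real.log_div (Real.exp_ne_zero _)
    (sum_exp_pos (v : EuclideanSpace ℝ (Fin K))).ne', Real.log_exp, Finset.sum_sub_distrib, hv,
    Finset.sum_const, Finset.card_univ, Fintype.card_fin, nsmul_eq_mul]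
  field_simp
  ring

lemma contDiffAt_centredLog {K : ℕ} {p : Fin K → ℝ} (hp : ∀ i, 0 < p i) :
    ContDiffAt ℝ 1 (centredLog (K := K)) p := by
  have h : ContDiffAt ℝ 1 (fun p : Fin K → ℝ => fun i => Real.log (p i)) p :=
    contDiffAt_pi.2 fun i =>
      (contDiff_apply ℝ ℝ i).contDiffAt.log (hp i).ne'
  exact (LinearMap.toContinuousLinearMap (centre K)).contDiff.contDiffAt.comp p h

/-- The log-odds vectors of the target class prior and of the columns of the confusion matrix. -/
abbrev LogOdds (K : ℕ) : Type := centred K × (Fin K → centred K)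

/-- The target class prior. -/
noncomputable def LogOdds.q {K : ℕ} (x : LogOdds K) : Fin K → ℝ :=
  softmax (x.1 : EuclideanSpace ℝ (Fin K))

/-- The confusion matrix. -/
noncomputable def LogOdds.conf {K : ℕ} (x : LogOdds K) : Matrix (Fin K) (Fin K) ℝ :=
  Matrix.of fun j i => softmax (x.2 i : EuclideanSpace ℝ (Fin K)) j

/-- The cell probabilities of all samples. -/
noncomputable def LogOdds.cells {K : ℕ} (x : LogOdds K) : Option (Fin K) → Fin K → ℝ :=
  GSBBSE.cells x.q x.conf

section cells

variable {K : ℕ} {q : Fin K → ℝ} {C : Matrix (Fin K) (Fin K) ℝ}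

lemma sum_mulVec_of_sum_col (hC1 : ∀ i, ∑ j, C j i = 1) (v : Fin K → ℝ) :
    ∑ j, C.mulVec v j = ∑ j, v j := by
  simp only [Matrix.mulVec, dotProduct]
  rw [Finset.sum_comm]
  simp only [← Finset.sum_mul, hC1, one_mul]

lemma cells_pos (hq : ∀ i, 0 < q i) (hC : ∀ j i, 0 < C j i) (o : Option (Fin K)) (j : Fin K) :
    0 < cells q C o j := by
  cases o with
  | none => exact Finset.sum_pos (fun i _ => mul_pos (hC j i) (hq i)) ⟨j, Finset.mem_univ j⟩
  | some i => exact hC j i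

lemma sum_cells (hq1 : ∑ i, q i = 1) (hC1 : ∀ i, ∑ j, C j i = 1) (o : Option (Fin K)) :
    ∑ j, cells q C o j = 1 := by
  cases o with
  | none => exact (sum_mulVec_of_sum_col hC1 q).trans hq1
  | some i => exact hC1 i

lemma LogOdds.cells_pos (x : LogOdds K) (o : Option (Fin K)) (j : Fin K) : 0 < x.cells o j :=
  GSBBSE.cells_pos (fun _ => softmax_pos _ _) (fun _ _ => softmax_pos _ _) o j

lemma LogOdds.sum_cells [NeZero K] (x : LogOdds K) (o : Option (Fin K)) :
    ∑ j, x.cells o j = 1 :=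
  GSBBSE.sum_cells (sum_softmax _) (fun _ => sum_softmax _) o

lemma LogOdds.contDiff_q [NeZero K] : ContDiff ℝ 1 (LogOdds.q (K := K)) :=
  contDiff_softmax.comp contDiff_fst

lemma LogOdds.contDiff_conf [NeZero K] (i j : Fin K) :
    ContDiff ℝ 1 fun x : LogOdds K => x.conf j i :=
  (contDiff_apply ℝ ℝ j).comp (contDiff_softmax.comp ((contDiff_apply ℝ _ i).comp contDiff_snd))

lemma LogOdds.contDiff_cells [NeZero K] : ContDiff ℝ 1 (LogOdds.cells (K := K)) := by
  refine contDiff_pi.2 fun o => contDiff_pi.2 fun j => ?_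
  cases o with
  | none =>
    change ContDiff ℝ 1 fun x : LogOdds K => ∑ i, x.conf j i * x.q i
    exact ContDiff.sum fun i _ =>
      (contDiff_conf i j).mul ((contDiff_apply ℝ ℝ i).comp contDiff_q)
  | some i => exact contDiff_conf i j

lemma norm_mulVec_le_of_entries {M : Matrix (Fin K) (Fin K) ℝ} {m : ℝ} (hm : 0 ≤ m)
    (hM : ∀ j i, |M j i| ≤ m) (v : Fin K → ℝ) : ‖M.mulVec v‖ ≤ K * m * ‖v‖ := by
  rw [pi_norm_le_iff_of_nonneg (by positivity)]
  intro j
  rw [Real.norm_eq_abs]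
  calc |∑ i, M j i * v i| ≤ ∑ i, |M j i * v i| := Finset.abs_sum_le_sum_abs _ _
    _ ≤ ∑ _i : Fin K, m * ‖v‖ := by
        refine Finset.sum_le_sum fun i _ => ?_
        rw [abs_mul]
        exact mul_le_mul (hM j i) (norm_le_pi_norm v i) (abs_nonneg _) hm
    _ = K * m * ‖v‖ := by simp [mul_assoc]

lemma exists_norm_le_mul_norm_mulVec {C₀ : Matrix (Fin K) (Fin K) ℝ} (hdet : C₀.det ≠ 0) :
    ∃ B : ℝ, 0 < B ∧ ∀ v, ‖v‖ ≤ B * ‖C₀.mulVec v‖ := by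
  obtain ⟨B, hB, h⟩ := (Matrix.toLin' C₀⁻¹).toContinuousLinearMap.bound
  refine ⟨B, hB, fun v => ?_⟩
  have := h (C₀.mulVec v)
  simpa [Matrix.mulVec_mulVec, Matrix.nonsing_inv_mul _ (isUnit_iff_ne_zero.2 hdet)] using this

lemma cells_some_sub_le {q q' : Fin K → ℝ} {C C' : Matrix (Fin K) (Fin K) ℝ} (j i : Fin K) :
    |C j i - C' j i| ≤ ‖cells q C - cells q' C'‖ :=
  (norm_le_pi_norm ((cells q C - cells q' C') (some i)) j).trans
    (norm_le_pi_norm (cells q C - cells q' C') (some i))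

/-- Near an invertible confusion matrix the class prior is a Lipschitz function of the cell
probabilities. -/
lemma exists_norm_sub_le_cells {C₀ : Matrix (Fin K) (Fin K) ℝ} (hdet : C₀.det ≠ 0) :
    ∃ r A : ℝ, 0 < r ∧ 0 < A ∧ ∀ C : Matrix (Fin K) (Fin K) ℝ, (∀ j i, |C j i - C₀ j i| ≤ r) →
      Function.Bijective C.mulVec ∧
      ∀ (q q' : Fin K → ℝ) (C' : Matrix (Fin K) (Fin K) ℝ), ‖q'‖ ≤ 1 →
        ‖q - q'‖ ≤ A * ‖cells q C - cells q' C'‖ := by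
  obtain ⟨B, hB, hinv⟩ := exists_norm_le_mul_norm_mulVec hdet
  refine ⟨1 / (2 * B * (K + 1)), 2 * B * (1 + K), by positivity, by positivity, fun C hC => ?_⟩
  have key (v : Fin K → ℝ) : ‖v‖ ≤ 2 * B * ‖C.mulVec v‖ := by
    have h1 := norm_mulVec_le_of_entries (M := C - C₀) (m := 1 / (2 * B * (K + 1)))
      (by positivity) hC v
    have h2 : C₀.mulVec v = C.mulVec v - (C - C₀).mulVec v := by
      rw [Matrix.sub_mulVec, sub_sub_cancel]
    have h3 := hinv v
    rw [h2] at h3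
    have h4 : ‖C.mulVec v - (C - C₀).mulVec v‖ ≤ ‖C.mulVec v‖ +
        K * (1 / (2 * B * (K + 1))) * ‖v‖ := (norm_sub_le _ _).trans (by gcongr)
    have h5 : B * (K * (1 / (2 * B * (K + 1))) * ‖v‖) ≤ 1 / 2 * ‖v‖ := by
      have : B * (K * (1 / (2 * B * (K + 1)))) ≤ 1 / 2 := by
        rw [show B * (K * (1 / (2 * B * (K + 1)))) = K / (K + 1) / 2 by field_simp]
        have : (K : ℝ) / (K + 1) ≤ 1 := (div_le_one (by positivity)).2 (by linarith)
        linarith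
      calc _ = B * (K * (1 / (2 * B * (K + 1)))) * ‖v‖ := by ring
        _ ≤ _ := by gcongr
    have h6 := mul_le_mul_of_nonneg_left h4 hB.le
    linarith
  have hinj : Function.Injective C.mulVec := fun v w hvw => by
    have := key (v - w)
    rw [Matrix.mulVec_sub, hvw, sub_self, norm_zero, mul_zero] at this
    exact sub_eq_zero.1 (norm_le_zero_iff.1 this)
  refine ⟨⟨hinj, (LinearMap.injective_iff_surjective (f := C.mulVecLin)).1 hinj⟩,
    fun q q' C' hq' => (key _).trans ?_⟩
  set D := ‖cells q C - cells q' C'‖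
  have h1 : ‖(C - C').mulVec q'‖ ≤ K * D := by
    refine (norm_mulVec_le_of_entries (norm_nonneg _)
      (fun j i => cells_some_sub_le (q := q) (q' := q') j i) q').trans ?_
    exact mul_le_of_le_one_right (by positivity) hq'
  have h2 : ‖C.mulVec q - C'.mulVec q'‖ ≤ D := norm_le_pi_norm (cells q C - cells q' C') none
  have h3 : C.mulVec (q - q') = (C.mulVec q - C'.mulVec q') - (C - C').mulVec q' := by
    rw [Matrix.mulVec_sub, Matrix.sub_mulVec]
    abel
  have h4 : ‖C.mulVec (q - q')‖ ≤ D + K * D := by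
    rw [h3]
    exact (norm_sub_le _ _).trans (add_le_add h2 h1)
  calc _ ≤ 2 * B * (D + K * D) := by gcongr
    _ = _ := by ring

end cells

open Metric Set
open scoped NNReal ENNReal Topology

section chart

variable {K : ℕ} {q₀ : Fin K → ℝ} {C₀ : Matrix (Fin K) (Fin K) ℝ}

lemma exists_lipschitzOnWith_centredLog {ι : Type*} [Finite ι] {p : ι → Fin K → ℝ}
    (hp : ∀ o i, 0 < p o i) :
    ∃ r : ℝ, 0 < r ∧ ∃ L : ℝ≥0, ∀ o, LipschitzOnWith L (centredLog (K := K)) (ball (p o) r) := by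
  cases nonempty_fintype ι
  choose L t ht hL using fun o => (contDiffAt_centredLog (hp o)).exists_lipschitzOnWith
  have h : ∀ᶠ r in 𝓝[>] (0 : ℝ), ∀ o, ball (p o) r ⊆ t o := by
    refine Filter.eventually_all.2 fun o => ?_
    obtain ⟨ε, hε, hs⟩ := Metric.mem_nhds_iff.1 (ht o)
    filter_upwards [Ioo_mem_nhdsGT hε] with r hr
    exact (ball_subset_ball hr.2.le).trans hs
  obtain ⟨r, hr, hr0⟩ := (h.and self_mem_nhdsWithin).exists
  exact ⟨r, hr0, Finset.univ.sup L, fun o =>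
    ((hL o).mono (hr o)).weaken (Finset.le_sup (Finset.mem_univ o))⟩

/-- The log-odds of given class prior and confusion matrix. -/
noncomputable def logOdds (q : Fin K → ℝ) (C : Matrix (Fin K) (Fin K) ℝ) : LogOdds K :=
  (centredLog q, fun i => centredLog fun j => C j i)

lemma cells_logOdds (hq : ∀ i, 0 < q₀ i) (hq1 : ∑ i, q₀ i = 1) (hC : ∀ j i, 0 < C₀ j i)
    (hC1 : ∀ i, ∑ j, C₀ j i = 1) : (logOdds q₀ C₀).cells = cells q₀ C₀ := by
  have h1 : (logOdds q₀ C₀).q = q₀ := softmax_centredLog hq hq1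
  have h2 : (logOdds q₀ C₀).conf = C₀ := by
    ext j i
    exact congrFun (softmax_centredLog (fun j => hC j i) (hC1 i)) j
  rw [LogOdds.cells, h1, h2]

lemma norm_le_one_of_sum_eq_one {q : Fin K → ℝ} (hq : ∀ i, 0 < q i) (hq1 : ∑ i, q i = 1) :
    ‖q‖ ≤ 1 := by
  rw [pi_norm_le_iff_of_nonneg zero_le_one]
  intro i
  rw [Real.norm_eq_abs, abs_of_pos (hq i), ← hq1]
  exact Finset.single_le_sum (fun i _ => (hq i).le) (Finset.mem_univ i)

lemma LogOdds.norm_q_le [NeZero K] (x : LogOdds K) : ‖x.q‖ ≤ 1 :=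
  norm_le_one_of_sum_eq_one (fun _ => softmax_pos _ _) (sum_softmax _)

lemma LogOdds.ext_cells [NeZero K] (x : LogOdds K) :
    x = (centredLog x.q, fun i => centredLog (x.cells (some i))) :=
  Prod.ext (centredLog_softmax x.1).symm (funext fun i => (centredLog_softmax (x.2 i)).symm)

/-- The cell probabilities are a bi-Lipschitz chart of the log-odds near the truth, and every
admissible value near the truth is attained. -/
lemma exists_biLipschitz_cells [NeZero K] (hq : ∀ i, 0 < q₀ i) (hq1 : ∑ i, q₀ i = 1)
    (hC : ∀ j i, 0 < C₀ j i) (hC1 : ∀ i, ∑ j, C₀ j i = 1) (hdet : C₀.det ≠ 0) :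
    ∃ r : ℝ, 0 < r ∧ ∃ L : ℝ≥0,
      (∀ x ∈ LogOdds.cells ⁻¹' ball (cells q₀ C₀) r,
        ∀ y ∈ LogOdds.cells ⁻¹' ball (cells q₀ C₀) r, dist x y ≤ L * dist x.cells y.cells) ∧
      LipschitzOnWith L LogOdds.cells (LogOdds.cells ⁻¹' ball (cells q₀ C₀) r) ∧
      ∀ w ∈ ball (cells q₀ C₀) r, (∀ o, ∑ j, w o j = 1) → ∃ y : LogOdds K, y.cells = w := by
  obtain ⟨r₁, A, hr₁, hA, hinv⟩ := exists_norm_sub_le_cells hdet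
  obtain ⟨r₂, hr₂, L₂, hL₂⟩ := exists_lipschitzOnWith_centredLog (ι := Unit) (p := fun _ => q₀)
    fun _ => hq
  obtain ⟨r₃, hr₃, L₃, hL₃⟩ := exists_lipschitzOnWith_centredLog (ι := Fin K)
    (p := fun i => cells q₀ C₀ (some i)) fun i => cells_pos hq hC (some i)
  obtain ⟨L₄, t, ht, hL₄⟩ :=
    (LogOdds.contDiff_cells (K := K)).contDiffAt (x := logOdds q₀ C₀) |>.exists_lipschitzOnWith
  obtain ⟨r₄, hr₄, ht⟩ := Metric.mem_nhds_iff.1 ht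
  set z₀ := cells q₀ C₀ with hz₀
  have hx₀ : (logOdds q₀ C₀).cells = z₀ := cells_logOdds hq hq1 hC hC1
  obtain ⟨m, hm, hmq⟩ : ∃ m : ℝ, 0 < m ∧ ∀ i, m ≤ q₀ i := by
    obtain ⟨i, hi⟩ := Finite.exists_min q₀
    exact ⟨q₀ i, hq i, hi⟩
  obtain ⟨m', hm', hmC⟩ : ∃ m : ℝ, 0 < m ∧ ∀ j i, m ≤ C₀ j i := by
    have : Nonempty (Fin K × Fin K) := ⟨0, 0⟩
    obtain ⟨a, ha⟩ := Finite.exists_min fun a : Fin K × Fin K => C₀ a.1 a.2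
    exact ⟨C₀ a.1 a.2, hC _ _, fun j i => ha (j, i)⟩
  set B : ℝ := max (L₂ * A) L₃ with hB
  have hB0 : 0 ≤ B := le_max_of_le_right L₃.2
  set r := min (min (min r₁ m') r₃) (min (r₂ / A) (min (r₄ / (B + 1)) (m / A))) with hr
  have hr0 : 0 < r := by positivity
  have hrr₁ : r ≤ r₁ :=
    (min_le_left _ _).trans ((min_le_left _ _).trans (min_le_left _ _))
  have hrm' : r ≤ m' := (min_le_left _ _).trans ((min_le_left _ _).trans (min_le_right _ _))
  have hrr₃ : r ≤ r₃ := (min_le_left _ _).trans (min_le_right _ _)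
  have hrr₂ : A * r ≤ r₂ := by
    have : r ≤ r₂ / A := (min_le_right _ _).trans (min_le_left _ _)
    rwa [le_div_iff₀ hA, mul_comm] at this
  have hrr₄ : (B + 1) * r ≤ r₄ := by
    have : r ≤ r₄ / (B + 1) :=
      (min_le_right _ _).trans ((min_le_right _ _).trans (min_le_left _ _))
    rwa [le_div_iff₀ (by positivity), mul_comm] at this
  have hrm : A * r ≤ m := by
    have : r ≤ m / A := (min_le_right _ _).trans ((min_le_right _ _).trans (min_le_right _ _))
    rwa [le_div_iff₀ hA, mul_comm] at this
  have hnear {q : Fin K → ℝ} {C : Matrix (Fin K) (Fin K) ℝ} (h : cells q C ∈ ball z₀ r) :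
      ∀ j i, |C j i - C₀ j i| ≤ r₁ := fun j i =>
    (cells_some_sub_le (q := q) (q' := q₀) j i).trans
      (((mem_ball_iff_norm.1 h).le).trans hrr₁)
  have hq₀n := norm_le_one_of_sum_eq_one hq hq1
  have hqnear {q : Fin K → ℝ} {C : Matrix (Fin K) (Fin K) ℝ} (h : cells q C ∈ ball z₀ r) :
      ‖q - q₀‖ < A * r :=
    ((hinv C (hnear h)).2 q q₀ C₀ hq₀n).trans_lt (by
      have := mem_ball_iff_norm.1 h
      gcongr)
  have hdist : ∀ x ∈ LogOdds.cells ⁻¹' ball z₀ r, ∀ y ∈ LogOdds.cells ⁻¹' ball z₀ r,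
      dist x y ≤ B * dist x.cells y.cells := by
    intro x hx y hy
    have h1 : dist x.1 y.1 ≤ B * dist x.cells y.cells := by
      have := (hL₂ ()).dist_le_mul x.q
        (mem_ball_iff_norm.2 ((hqnear hx).trans_le hrr₂)) y.q
        (mem_ball_iff_norm.2 ((hqnear hy).trans_le hrr₂))
      have h' : dist x.q y.q ≤ A * dist x.cells y.cells := by
        rw [dist_eq_norm, dist_eq_norm]
        exact (hinv x.conf (hnear hx)).2 x.q y.q y.conf y.norm_q_le
      rw [show x.1 = centredLog x.q from (centredLog_softmax x.1).symm,
        show y.1 = centredLog y.q from (centredLog_softmax y.1).symm]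
      calc _ ≤ _ := this
        _ ≤ L₂ * (A * dist x.cells y.cells) := by gcongr
        _ = L₂ * A * dist x.cells y.cells := by ring
        _ ≤ _ := by
          gcongr
          exact le_max_left _ _
    have h2 : dist x.2 y.2 ≤ B * dist x.cells y.cells := by
      rw [dist_pi_le_iff (by positivity)]
      intro i
      have hmem {x : LogOdds K} (hx : x ∈ LogOdds.cells ⁻¹' ball z₀ r) :
          x.cells (some i) ∈ ball (z₀ (some i)) r₃ :=
        mem_ball.2 ((dist_le_pi_dist x.cells z₀ (some i)).trans_lt ((mem_ball.1 hx).trans_le hrr₃))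
      have := (hL₃ i).dist_le_mul _ (hmem hx) _ (hmem hy)
      rw [congrArg Prod.snd x.ext_cells, congrArg Prod.snd y.ext_cells]
      calc _ ≤ _ := this
        _ ≤ L₃ * dist x.cells y.cells := by
          gcongr
          exact dist_le_pi_dist x.cells y.cells (some i)
        _ ≤ _ := by
          gcongr
          exact le_max_right _ _
    exact max_le h1 h2
  refine ⟨r, hr0, max B.toNNReal L₄, fun x hx y hy => (hdist x hx y hy).trans ?_, ?_, ?_⟩
  · gcongr
    rw [NNReal.coe_max, Real.coe_toNNReal _ hB0]
    exact le_max_left _ _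
  · refine (hL₄.mono fun x hx => ht ?_).weaken (le_max_right _ _)
    rw [mem_ball]
    refine (hdist x hx _ ?_).trans_lt ?_
    · rw [mem_preimage, hx₀]
      exact mem_ball_self hr0
    · rw [hx₀]
      have := mem_ball.1 hx
      nlinarith [dist_nonneg (x := x.cells) (y := z₀)]
  · intro w hw hw1
    set C : Matrix (Fin K) (Fin K) ℝ := Matrix.of fun j i => w (some i) j with hCdef
    have hCnear' : ∀ j i, |C j i - C₀ j i| < r := fun j i =>
      ((norm_le_pi_norm ((w - z₀) (some i)) j).trans (norm_le_pi_norm (w - z₀) (some i))).trans_lt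
        (mem_ball_iff_norm.1 hw)
    obtain ⟨q, hqw⟩ := (hinv C fun j i => (hCnear' j i).le.trans hrr₁).1.2 (w none)
    have hCpos : ∀ j i, 0 < C j i := fun j i => by
      have := (abs_lt.1 ((hCnear' j i).trans_le (hrm'.trans (hmC j i)))).1
      linarith
    have hcw : cells q C = w := by
      funext o
      cases o with
      | none => exact hqw
      | some i => rfl
    have hC1' : ∀ i, ∑ j, C j i = 1 := fun i => hw1 (some i)
    have hq1' : ∑ i, q i = 1 := by
      rw [← sum_mulVec_of_sum_col hC1', hqw]
      exact hw1 none
    have hqpos : ∀ i, 0 < q i := fun i => by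
      have h := (norm_le_pi_norm (q - q₀) i).trans_lt (hqnear (q := q) (C := C) (hcw ▸ hw))
      have := (abs_lt.1 (h.trans_le (hrm.trans (hmq i)))).1
      simp only [Pi.sub_apply] at this
      linarith
    exact ⟨logOdds q C, (cells_logOdds hqpos hq1' hCpos hC1').trans hcw⟩

end chart

section doubling

variable {X Z : Type*} [NormedAddCommGroup X] [NormedSpace ℝ X] [FiniteDimensional ℝ X]
  [MeasurableSpace X] [BorelSpace X] (μ : Measure X) [μ.IsAddHaarMeasure]
  [NormedAddCommGroup Z] [NormedSpace ℝ Z] {Φ : X → Z} {U : Set X} {L : ℝ≥0} {z : Z}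

/-- If a bi-Lipschitz chart maps a set onto a set that contains the midpoints with `z`, then the
contraction by one half towards `z`, read in the chart, shrinks measures at most by a factor that
depends only on the dimension and the Lipschitz constants. -/
lemma measure_inter_preimage_le_of_midpoint (hlip : LipschitzOnWith L Φ U)
    (hanti : ∀ x ∈ U, ∀ y ∈ U, dist x y ≤ L * dist (Φ x) (Φ y))
    (hmid : ∀ x ∈ U, ∃ y ∈ U, (2 : ℝ) • Φ y - z = Φ x) (B : Set Z) :
    μ (U ∩ Φ ⁻¹' B) ≤ ((2 * L * L : ℝ≥0) : ℝ≥0∞) ^ (Module.finrank ℝ X : ℝ) *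
      μ (U ∩ (fun y => (2 : ℝ) • Φ y - z) ⁻¹' B) := by
  classical
  rw [Measure.isAddLeftInvariant_eq_smul μ (Measure.hausdorffMeasure (Module.finrank ℝ X : ℝ))]
  simp only [Measure.smul_apply, ENNReal.smul_def, smul_eq_mul]
  rw [mul_left_comm]
  gcongr
  have hG : ∀ y, ∃ x, y ∈ {y | ∃ x ∈ U, Φ x = (2 : ℝ) • Φ y - z} →
      x ∈ U ∧ Φ x = (2 : ℝ) • Φ y - z := fun y => by
    by_cases h : ∃ x ∈ U, Φ x = (2 : ℝ) • Φ y - z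
    · obtain ⟨x, hx⟩ := h
      exact ⟨x, fun _ => hx⟩
    · exact ⟨y, fun h' => absurd h' h⟩
  choose G hG using hG
  set s : Set X := {y | y ∈ U ∧ (2 : ℝ) • Φ y - z ∈ B ∧ ∃ x ∈ U, Φ x = (2 : ℝ) • Φ y - z}
    with hs
  have hGlip : LipschitzOnWith (2 * L * L) G s := by
    refine LipschitzOnWith.of_dist_le_mul fun y hy y' hy' => ?_
    have h1 := hG y hy.2.2
    have h2 := hG y' hy'.2.2
    have h3 := hanti _ h1.1 _ h2.1
    rw [h1.2, h2.2, dist_sub_right, dist_smul₀, Real.norm_eq_abs, abs_of_pos two_pos] at h3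
    have h4 := hlip.dist_le_mul y hy.1 y' hy'.1
    calc _ ≤ _ := h3
      _ ≤ L * (2 * (L * dist y y')) := by gcongr
      _ = _ := by
        push_cast
        ring
  have hsub : U ∩ Φ ⁻¹' B ⊆ G '' s := by
    rintro x ⟨hxU, hxB⟩
    obtain ⟨y, hy, hyx⟩ := hmid x hxU
    have hys : y ∈ s := ⟨hy, by rw [hyx]; exact hxB, x, hxU, hyx.symm⟩
    refine ⟨y, hys, ?_⟩
    have h1 := hG y hys.2.2
    have h2 := hanti _ h1.1 _ hxU
    rw [h1.2, hyx, dist_self, mul_zero] at h2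
    exact dist_le_zero.1 h2
  calc _ ≤ Measure.hausdorffMeasure (Module.finrank ℝ X : ℝ) (G '' s) := measure_mono hsub
    _ ≤ _ := hGlip.hausdorffMeasure_image_le (Nat.cast_nonneg _)
    _ ≤ _ := by
      gcongr
      exact fun y hy => ⟨hy.1, hy.2.1⟩

lemma setLIntegral_le_of_midpoint [MeasurableSpace Z] [BorelSpace Z]
    (hΦ : Measurable Φ) (hlip : LipschitzOnWith L Φ U)
    (hanti : ∀ x ∈ U, ∀ y ∈ U, dist x y ≤ L * dist (Φ x) (Φ y))
    (hmid : ∀ x ∈ U, ∃ y ∈ U, (2 : ℝ) • Φ y - z = Φ x) {g : Z → ℝ≥0∞} (hg : Measurable g) :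
    ∫⁻ x in U, g (Φ x) ∂μ ≤ ((2 * L * L : ℝ≥0) : ℝ≥0∞) ^ (Module.finrank ℝ X : ℝ) *
      ∫⁻ y in U, g ((2 : ℝ) • Φ y - z) ∂μ := by
  have hm : Measurable fun w : Z => (2 : ℝ) • w - z :=
    (continuous_id.const_smul (2 : ℝ) |>.sub continuous_const).measurable
  have hm' : Measurable fun y => (2 : ℝ) • Φ y - z := hm.comp hΦ
  have hmap : ∫⁻ y in U, g ((2 : ℝ) • Φ y - z) ∂μ =
      ∫⁻ w, g w ∂((μ.restrict U).map fun y => (2 : ℝ) • Φ y - z) :=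
    (lintegral_map hg hm').symm
  rw [← lintegral_map hg hΦ, hmap, ← smul_eq_mul, ← lintegral_smul_measure]
  refine lintegral_mono' (Measure.le_iff.2 fun B hB => ?_) le_rfl
  rw [Measure.map_apply hΦ hB, Measure.smul_apply, Measure.map_apply hm' hB,
    Measure.restrict_apply (hΦ hB), Measure.restrict_apply (hm' hB), smul_eq_mul,
    inter_comm, inter_comm _ U]
  exact measure_inter_preimage_le_of_midpoint μ hlip hanti hmid B

end doubling

section deviance

variable {K : ℕ}

/-- The deviance of the cell probabilities `w` from the frequencies `f` for the sample sizes
`n`. -/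
noncomputable def deviance (n : Option (Fin K) → ℕ) (f w : Option (Fin K) → Fin K → ℝ) : ℝ :=
  ∑ o, n o * relEnt (f o) (w o)

lemma measurable_deviance (n : Option (Fin K) → ℕ) (f : Option (Fin K) → Fin K → ℝ) :
    Measurable (deviance n f) :=
  Finset.measurable_fun_sum _ fun o _ =>
    ((measurable_relEnt (f o)).comp (measurable_pi_apply o)).const_mul _

lemma deviance_nonneg {n : Option (Fin K) → ℕ} {f w : Option (Fin K) → Fin K → ℝ}
    (hf : ∀ o j, 0 < f o j) (hw : ∀ o j, 0 < w o j) (hf1 : ∀ o, ∑ j, f o j = 1)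
    (hw1 : ∀ o, ∑ j, w o j = 1) : 0 ≤ deviance n f w :=
  Finset.sum_nonneg fun o _ =>
    mul_nonneg (Nat.cast_nonneg _) (relEnt_nonneg (hf o) (hw o) (hf1 o) (hw1 o))

/-- A weak form of Pinsker's inequality for all samples together. -/
lemma mul_norm_sub_sq_le_deviance {n : Option (Fin K) → ℕ} {f w : Option (Fin K) → Fin K → ℝ}
    (hf : ∀ o j, 0 < f o j) (hw : ∀ o j, 0 < w o j) (hf1 : ∀ o, ∑ j, f o j = 1)
    (hw1 : ∀ o, ∑ j, w o j = 1) {m : ℝ} (hm0 : 0 ≤ m) (hm : ∀ o, m ≤ n o) :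
    m * ‖w - f‖ ^ 2 ≤ 4 * deviance n f w := by
  have hS := deviance_nonneg (n := n) hf hw hf1 hw1
  have hentry : ∀ o j, m * ‖(w - f) o j‖ ^ 2 ≤ 4 * deviance n f w := fun o j => by
    have h1 : ‖(w - f) o j‖ ^ 2 ≤ ∑ j, (f o j - w o j) ^ 2 := by
      rw [Real.norm_eq_abs, sq_abs, Pi.sub_apply, Pi.sub_apply, sub_sq_comm]
      exact Finset.single_le_sum (f := fun j => (f o j - w o j) ^ 2)
        (fun j _ => sq_nonneg _) (Finset.mem_univ j)
    have h2 := sum_sq_sub_le_relEnt (hf o) (hw o) (hf1 o) (hw1 o)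
    have h0 := relEnt_nonneg (hf o) (hw o) (hf1 o) (hw1 o)
    have h3 : n o * relEnt (f o) (w o) ≤ deviance n f w :=
      Finset.single_le_sum (f := fun o => n o * relEnt (f o) (w o)) (fun o _ =>
        mul_nonneg (Nat.cast_nonneg _) (relEnt_nonneg (hf o) (hw o) (hf1 o) (hw1 o)))
        (Finset.mem_univ o)
    have h4 := mul_le_mul_of_nonneg_left (h1.trans h2) hm0
    have h5 := mul_le_mul_of_nonneg_right (hm o) h0
    linarith
  rcases hm0.eq_or_lt with rfl | hm0
  · rw [zero_mul]
    positivity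
  have hn : ‖w - f‖ ≤ √(4 * deviance n f w / m) := by
    refine (pi_norm_le_iff_of_nonneg (Real.sqrt_nonneg _)).2 fun o =>
      (pi_norm_le_iff_of_nonneg (Real.sqrt_nonneg _)).2 fun j => Real.le_sqrt_of_sq_le ?_
    rw [le_div_iff₀ hm0, mul_comm]
    exact hentry o j
  have := (Real.le_sqrt (norm_nonneg _) (by positivity)).1 hn
  rwa [le_div_iff₀ hm0, mul_comm] at this

lemma two_mul_deviance_midpoint_le {n : Option (Fin K) → ℕ}
    {f p w : Option (Fin K) → Fin K → ℝ} (hf : ∀ o j, 0 < f o j) (hp : ∀ o j, 0 < p o j)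
    (hw : ∀ o j, 2 * w o j = f o j + p o j) : 2 * deviance n f w ≤ deviance n f p := by
  rw [deviance, deviance, Finset.mul_sum]
  refine Finset.sum_le_sum fun o _ => ?_
  have := two_mul_relEnt_midpoint_le (hf o) (hp o) (hw o)
  nlinarith [Nat.cast_nonneg (α := ℝ) (n o)]

lemma exists_deviance_le {z : Option (Fin K) → Fin K → ℝ} (hz : ∀ o j, 0 < z o j) {c : ℝ}
    (hc : 0 < c) : ∃ η : ℝ, 0 < η ∧ ∀ f ∈ ball z η, ∀ w ∈ ball z η,
      ∀ n : Option (Fin K) → ℕ, deviance n f w ≤ c * ∑ o, (n o : ℝ) := by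
  have h : ∀ᶠ x in 𝓝 (z, z), ∀ o, relEnt (x.1 o) (x.2 o) < c := by
    refine Filter.eventually_all.2 fun o => ?_
    have h1 : ContinuousAt (fun x : (Option (Fin K) → Fin K → ℝ) × (Option (Fin K) → Fin K → ℝ) =>
        (x.1 o, x.2 o)) (z, z) := by fun_prop
    have h2 := ContinuousAt.comp (f := fun x : (Option (Fin K) → Fin K → ℝ) ×
      (Option (Fin K) → Fin K → ℝ) => (x.1 o, x.2 o)) (continuousAt_relEnt (hz o) (hz o)) h1
    refine h2.eventually_lt_const ?_
    simpa [relEnt_self (hz o)] using hc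
  obtain ⟨η, hη, hs⟩ := Metric.eventually_nhds_iff_ball.1 h
  refine ⟨η, hη, fun f hf w hw n => ?_⟩
  rw [deviance, Finset.mul_sum]
  refine Finset.sum_le_sum fun o _ => ?_
  rw [mul_comm]
  refine mul_le_mul_of_nonneg_right (hs (f, w) ?_ o).le (Nat.cast_nonneg _)
  rw [← ball_prod_same]
  exact ⟨hf, hw⟩

lemma mul_exp_neg_le {s : ℝ} : s * Real.exp (-s) ≤ Real.exp (-(s / 2)) := by
  have h1 : s ≤ Real.exp (s / 2) := by
    have h := Real.add_one_le_exp (s / 4)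
    rw [show s / 2 = (2 : ℕ) * (s / 4) by push_cast; ring, Real.exp_nat_mul]
    rcases le_total 0 s with hs | hs
    · nlinarith [sq_nonneg (1 - s / 4)]
    · exact hs.trans (by positivity)
  calc s * Real.exp (-s) ≤ Real.exp (s / 2) * Real.exp (-s) := by gcongr
    _ = _ := by rw [← Real.exp_add]; congr 1; ring

lemma pos_of_mem_ball {z w : Option (Fin K) → Fin K → ℝ} {r : ℝ} (hr : ∀ o j, r ≤ z o j)
    (hw : w ∈ ball z r) (o : Option (Fin K)) (j : Fin K) : 0 < w o j := by
  have h := ((norm_le_pi_norm ((w - z) o) j).trans (norm_le_pi_norm (w - z) o)).trans_lt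
    (mem_ball_iff_norm.1 hw)
  have := (abs_lt.1 (h.trans_le (hr o j))).1
  simp only [Pi.sub_apply] at this
  linarith

end deviance

instance (K : ℕ) : (centredLebesgue K).IsAddHaarMeasure :=
  inferInstanceAs (stdOrthonormalBasis ℝ (centred K)).toBasis.addHaar.IsAddHaarMeasure

/-- Lebesgue measure on the log-odds. -/
noncomputable def logOddsLebesgue (K : ℕ) : Measure (LogOdds K) :=
  (centredLebesgue K).prod (Measure.pi fun _ : Fin K => centredLebesgue K)

instance (K : ℕ) : (logOddsLebesgue K).IsAddHaarMeasure :=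
  Measure.prod.instIsAddHaarMeasure _ _

/-- The Borel structure, for the topology of the norm. -/
instance (K : ℕ) : @BorelSpace (LogOdds K) (inferInstance : NormedAddCommGroup
    (LogOdds K)).toMetricSpace.toPseudoMetricSpace.toUniformSpace.toTopologicalSpace
    inferInstance :=
  (inferInstance : BorelSpace (LogOdds K))

section core

variable {K : ℕ} [NeZero K] {q₀ : Fin K → ℝ} {C₀ : Matrix (Fin K) (Fin K) ℝ}

lemma continuous_cells : Continuous (LogOdds.cells (K := K)) :=
  LogOdds.contDiff_cells.continuous

lemma measurable_cells : Measurable (LogOdds.cells (K := K)) :=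
  continuous_cells.measurable

/-- The part of the numerator near the truth. -/
lemma exists_setLIntegral_exp_half_deviance_le (hq : ∀ i, 0 < q₀ i) (hq1 : ∑ i, q₀ i = 1)
    (hC : ∀ j i, 0 < C₀ j i) (hC1 : ∀ i, ∑ j, C₀ j i = 1) (hdet : C₀.det ≠ 0) :
    ∃ c : ℝ≥0, ∃ r : ℝ, 0 < r ∧ ∃ L : ℝ≥0,
      (∀ x : LogOdds K, x.cells ∈ ball (cells q₀ C₀) r →
        dist x (logOdds q₀ C₀) ≤ L * dist x.cells (cells q₀ C₀)) ∧
      (∀ o j, r ≤ cells q₀ C₀ o j) ∧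
      ∀ η ≤ r, ∀ f ∈ ball (cells q₀ C₀) η, (∀ o, ∑ j, f o j = 1) → ∀ n : Option (Fin K) → ℕ,
        ∫⁻ x in LogOdds.cells ⁻¹' ball (cells q₀ C₀) η,
            ENNReal.ofReal (Real.exp (-(deviance n f x.cells / 2))) ∂(logOddsLebesgue K) ≤
          c * ∫⁻ x in LogOdds.cells ⁻¹' ball (cells q₀ C₀) η,
            ENNReal.ofReal (Real.exp (-deviance n f x.cells)) ∂(logOddsLebesgue K) := by
  obtain ⟨r, hr, L, hanti, hlip, hsurj⟩ := exists_biLipschitz_cells hq hq1 hC hC1 hdet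
  have hx₀ : (logOdds q₀ C₀).cells = cells q₀ C₀ := cells_logOdds hq hq1 hC hC1
  set z := cells q₀ C₀
  obtain ⟨m, hm, hmz⟩ : ∃ m : ℝ, 0 < m ∧ ∀ o j, m ≤ z o j := by
    have : Nonempty (Option (Fin K) × Fin K) := ⟨none, 0⟩
    obtain ⟨a, ha⟩ := Finite.exists_min fun a : Option (Fin K) × Fin K => z a.1 a.2
    exact ⟨z a.1 a.2, cells_pos hq hC _ _, fun o j => ha (o, j)⟩
  refine ⟨(2 * L * L) ^ (Module.finrank ℝ (LogOdds K)), min r (m / 3), by positivity, L,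
    fun x hx => ?_, fun o j => ?_, fun η hη f hf hf1 n => ?_⟩
  · rw [← hx₀]
    refine hanti x (ball_subset_ball (min_le_left _ _) hx) _ ?_
    rw [mem_preimage, hx₀]
    exact mem_ball_self hr
  · have := hmz o j
    exact (min_le_right _ _).trans (by linarith)
  have hηr : η ≤ r := hη.trans (min_le_left _ _)
  have hηm : η ≤ m / 3 := hη.trans (min_le_right _ _)
  have hfpos : ∀ o j, 0 < f o j :=
    pos_of_mem_ball (r := η) (fun o j => by linarith [hmz o j]) hf
  set U := LogOdds.cells ⁻¹' ball z η with hU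
  have hUm : MeasurableSet U := measurable_cells measurableSet_ball
  have hUsub : U ⊆ LogOdds.cells ⁻¹' ball z r := fun x hx => ball_subset_ball hηr hx
  have hmid : ∀ x ∈ U, ∃ y ∈ U, (2 : ℝ) • y.cells - f = x.cells := by
    intro x hx
    have hw : (1 / 2 : ℝ) • x.cells + (1 / 2 : ℝ) • f ∈ ball z η :=
      convex_ball z η hx hf (by norm_num) (by norm_num) (by norm_num)
    obtain ⟨y, hy⟩ := hsurj _ (ball_subset_ball hηr hw) fun o => by
      simp only [Pi.add_apply, Pi.smul_apply, smul_eq_mul, Finset.sum_add_distrib,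
        ← Finset.mul_sum, x.sum_cells, hf1]
      norm_num
    refine ⟨y, by rwa [hU, mem_preimage, hy], ?_⟩
    rw [hy, smul_add, smul_smul, smul_smul]
    norm_num
  have h := setLIntegral_le_of_midpoint (logOddsLebesgue K) measurable_cells
    (hlip.mono hUsub) (fun x hx y hy => hanti x (hUsub hx) y (hUsub hy)) hmid
    (g := fun w => ENNReal.ofReal (Real.exp (-(deviance n f w / 2))))
    (((measurable_deviance n f).div_const 2).neg.exp.ennreal_ofReal)
  refine h.trans ?_
  rw [ENNReal.rpow_natCast, ENNReal.coe_pow]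
  refine mul_le_mul' le_rfl (setLIntegral_mono' hUm fun y hy => ENNReal.ofReal_le_ofReal (Real.exp_le_exp.2 ?_))
  have hp : ∀ o j, 0 < ((2 : ℝ) • y.cells - f) o j := by
    refine pos_of_mem_ball hmz ?_
    rw [mem_ball_iff_norm, show (2 : ℝ) • y.cells - f - z =
      (2 : ℝ) • (y.cells - z) - (f - z) by rw [smul_sub, two_smul, two_smul]; abel]
    have h1 := mem_ball_iff_norm.1 hf
    have h2 := mem_ball_iff_norm.1 (show y.cells ∈ ball z η from hy)
    have h3 := norm_sub_le ((2 : ℝ) • (y.cells - z)) (f - z)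
    rw [norm_smul, Real.norm_eq_abs, abs_of_pos two_pos] at h3
    linarith
  have := two_mul_deviance_midpoint_le (n := n) hfpos hp (w := y.cells) fun o j => by
    simp only [Pi.sub_apply, Pi.smul_apply, smul_eq_mul]
    ring
  linarith

/-- The posterior expectation of the deviance is bounded by a constant that depends only on the
truth. -/
lemma exists_lintegral_deviance_le (hq : ∀ i, 0 < q₀ i) (hq1 : ∑ i, q₀ i = 1)
    (hC : ∀ j i, 0 < C₀ j i) (hC1 : ∀ i, ∑ j, C₀ j i = 1) (hdet : C₀.det ≠ 0) :
    ∃ c : ℝ≥0, ∀ π : LogOdds K → ℝ≥0∞, Measurable π → ∫⁻ x, π x ∂(logOddsLebesgue K) ≤ 1 →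
      ContinuousAt π (logOdds q₀ C₀) → π (logOdds q₀ C₀) ≠ 0 → π (logOdds q₀ C₀) ≠ ∞ →
      ∀ ρ : ℝ, 0 < ρ → ∃ ε : ℝ, 0 < ε ∧ ∃ N₀ : ℕ, ∀ n : Option (Fin K) → ℕ, N₀ ≤ ∑ o, n o →
        (∀ o, ρ * ∑ o, (n o : ℝ) ≤ n o) →
        ∀ f ∈ ball (cells q₀ C₀) ε, (∀ o, ∑ j, f o j = 1) →
          (∫⁻ x, ENNReal.ofReal (Real.exp (-deviance n f x.cells)) * π x
            ∂(logOddsLebesgue K)) ≠ 0 ∧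
          ∫⁻ x, ENNReal.ofReal (deviance n f x.cells * Real.exp (-deviance n f x.cells)) * π x
              ∂(logOddsLebesgue K) ≤
            c * ∫⁻ x, ENNReal.ofReal (Real.exp (-deviance n f x.cells)) * π x
              ∂(logOddsLebesgue K) := by
  obtain ⟨c, r, hr, L, hdist, hrz, hhalf⟩ :=
    exists_setLIntegral_exp_half_deviance_le hq hq1 hC hC1 hdet
  have hzpos := cells_pos hq hC
  have hx₀ : (logOdds q₀ C₀).cells = cells q₀ C₀ := cells_logOdds hq hq1 hC hC1
  set z := cells q₀ C₀
  set x₀ := logOdds q₀ C₀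
  set μ := logOddsLebesgue K
  refine ⟨4 * c + 1, fun π hπ hπ1 hcont hπ0 hπt ρ hρ => ?_⟩
  set a := π x₀
  have hnhds : ∀ᶠ x in 𝓝 x₀, a / 2 < π x ∧ π x < 2 * a := by
    refine (hcont.eventually_const_lt (ENNReal.half_lt_self hπ0 hπt)).and
      (hcont.eventually_lt_const ?_)
    rw [two_mul]
    exact ENNReal.lt_add_right hπt hπ0
  obtain ⟨s, hs, hball⟩ := Metric.eventually_nhds_iff_ball.1 hnhds
  set η := min r (s / (L + 1)) with hηdef
  have hη : 0 < η := by positivity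
  set U := LogOdds.cells ⁻¹' ball z η with hUdef
  have hUm : MeasurableSet U := measurable_cells measurableSet_ball
  have hUπ : ∀ x ∈ U, a / 2 ≤ π x ∧ π x ≤ 2 * a := by
    intro x hx
    have hxη : dist x.cells z < η := hx
    have h1 := hdist x (ball_subset_ball (min_le_left _ _) hx)
    have h2 : (L + 1) * η ≤ s := by
      have : η ≤ s / (L + 1) := min_le_right _ _
      rwa [le_div_iff₀ (by positivity), mul_comm] at this
    have := hball x (mem_ball.2 (by
      nlinarith [L.2, dist_nonneg (x := x.cells) (y := z),
        mul_le_mul_of_nonneg_left hxη.le L.2]))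
    exact ⟨this.1.le, this.2.le⟩
  set b := ρ * η ^ 2 / 16 with hbdef
  have hb : 0 < b := by positivity
  obtain ⟨ζ, hζ, hdev⟩ := exists_deviance_le hzpos (c := b / 4) (by positivity)
  set V := LogOdds.cells ⁻¹' ball z (min η ζ) with hVdef
  have hVo : IsOpen V := isOpen_ball.preimage continuous_cells
  have hVU : V ⊆ U := preimage_mono (ball_subset_ball (min_le_left _ _))
  have hVpos : 0 < μ V := by
    refine hVo.measure_pos μ ⟨x₀, ?_⟩
    rw [hVdef, mem_preimage, hx₀]
    exact mem_ball_self (by positivity)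
  have hβ : 0 < a / 2 * μ V := ENNReal.mul_pos (ENNReal.half_pos hπ0).ne' hVpos.ne'
  have htend : Filter.Tendsto (fun N : ℕ => ENNReal.ofReal (Real.exp (-(b / 4 * N))))
      Filter.atTop (𝓝 0) := by
    rw [← ENNReal.ofReal_zero]
    refine ENNReal.tendsto_ofReal (Real.tendsto_exp_neg_atTop_nhds_zero.comp ?_)
    exact tendsto_natCast_atTop_atTop.const_mul_atTop (by positivity)
  obtain ⟨N₀, hN₀⟩ := Filter.eventually_atTop.1 (htend.eventually_le_const hβ)
  refine ⟨min (η / 2) ζ, by positivity, N₀, fun n hn hρn f hf hf1 => ?_⟩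
  have hfη : f ∈ ball z (η / 2) := ball_subset_ball (min_le_left _ _) hf
  have hfζ : f ∈ ball z ζ := ball_subset_ball (min_le_right _ _) hf
  have hfη' : f ∈ ball z η := ball_subset_ball (by linarith) hfη
  have hfpos : ∀ o j, 0 < f o j :=
    pos_of_mem_ball hrz (ball_subset_ball (min_le_left _ _) hfη')
  set N : ℕ := ∑ o, n o with hN
  have hNcast : ∑ o, (n o : ℝ) = N := by rw [hN]; push_cast; rfl
  set S : LogOdds K → ℝ := fun x => deviance n f x.cells with hS
  have hSm : Measurable S := (measurable_deviance n f).comp measurable_cells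
  have hem : Measurable fun x => ENNReal.ofReal (Real.exp (-S x)) := hSm.neg.exp.ennreal_ofReal
  set T := ∫⁻ x, ENNReal.ofReal (Real.exp (-S x)) * π x ∂μ with hT
  have hlow : ENNReal.ofReal (Real.exp (-(b / 2 * N))) ≤ T := by
    calc ENNReal.ofReal (Real.exp (-(b / 2 * N)))
        = ENNReal.ofReal (Real.exp (-(b / 4 * N))) * ENNReal.ofReal (Real.exp (-(b / 4 * N))) := by
          rw [← ENNReal.ofReal_mul (by positivity), ← Real.exp_add]
          congr 2
          ring
      _ ≤ ENNReal.ofReal (Real.exp (-(b / 4 * N))) * (a / 2 * μ V) := by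
          gcongr
          exact hN₀ N hn
      _ = ∫⁻ _x in V, ENNReal.ofReal (Real.exp (-(b / 4 * N))) * (a / 2) ∂μ := by
          rw [setLIntegral_const, mul_assoc]
      _ ≤ ∫⁻ x in V, ENNReal.ofReal (Real.exp (-S x)) * π x ∂μ := by
          refine setLIntegral_mono' hVo.measurableSet fun x hx => ?_
          gcongr
          · have := hdev f hfζ x.cells (ball_subset_ball (min_le_right _ _) hx) n
            rwa [hNcast] at this
          · exact (hUπ x (hVU hx)).1
      _ ≤ T := setLIntegral_le_lintegral _ _
  have hTpos : 0 < T := lt_of_lt_of_le (by positivity) hlow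
  refine ⟨hTpos.ne', ?_⟩
  have hup : ∀ x, ENNReal.ofReal (S x * Real.exp (-S x)) * π x ≤
      ENNReal.ofReal (Real.exp (-(S x / 2))) * π x := fun x => by
    gcongr
    exact mul_exp_neg_le
  calc ∫⁻ x, ENNReal.ofReal (S x * Real.exp (-S x)) * π x ∂μ
      ≤ ∫⁻ x, ENNReal.ofReal (Real.exp (-(S x / 2))) * π x ∂μ := lintegral_mono hup
    _ = (∫⁻ x in U, ENNReal.ofReal (Real.exp (-(S x / 2))) * π x ∂μ) +
        ∫⁻ x in Uᶜ, ENNReal.ofReal (Real.exp (-(S x / 2))) * π x ∂μ :=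
        (lintegral_add_compl _ hUm).symm
    _ ≤ 4 * c * T + T := by
        refine add_le_add ?_ ?_
        · calc ∫⁻ x in U, ENNReal.ofReal (Real.exp (-(S x / 2))) * π x ∂μ
              ≤ ∫⁻ x in U, ENNReal.ofReal (Real.exp (-(S x / 2))) * (2 * a) ∂μ := by
                refine setLIntegral_mono' hUm fun x hx => ?_
                gcongr
                exact (hUπ x hx).2
            _ = (∫⁻ x in U, ENNReal.ofReal (Real.exp (-(S x / 2))) ∂μ) * (2 * a) :=
                lintegral_mul_const _ (hSm.div_const 2).neg.exp.ennreal_ofReal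
            _ ≤ c * (∫⁻ x in U, ENNReal.ofReal (Real.exp (-S x)) ∂μ) * (2 * a) := by
                gcongr
                exact hhalf η (min_le_left _ _) f hfη' hf1 n
            _ = 4 * c * ((∫⁻ x in U, ENNReal.ofReal (Real.exp (-S x)) ∂μ) * (a / 2)) := by
                have : 2 * a = 4 * (a / 2) := by
                  rw [show (4 : ℝ≥0∞) = 2 * 2 by norm_num, mul_assoc,
                    ENNReal.mul_div_cancel two_ne_zero ENNReal.ofNat_ne_top]
                rw [this]
                ring
            _ = 4 * c * ∫⁻ x in U, ENNReal.ofReal (Real.exp (-S x)) * (a / 2) ∂μ := by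
                rw [lintegral_mul_const _ hem]
            _ ≤ 4 * c * ∫⁻ x in U, ENNReal.ofReal (Real.exp (-S x)) * π x ∂μ := by
                gcongr 4 * c * ?_
                refine setLIntegral_mono' hUm fun x hx => ?_
                gcongr
                exact (hUπ x hx).1
            _ ≤ 4 * c * T := by
                gcongr 4 * c * ?_
                exact setLIntegral_le_lintegral _ _
        · refine le_trans ?_ hlow
          calc ∫⁻ x in Uᶜ, ENNReal.ofReal (Real.exp (-(S x / 2))) * π x ∂μ
              ≤ ∫⁻ x in Uᶜ, ENNReal.ofReal (Real.exp (-(b / 2 * N))) * π x ∂μ := by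
                refine setLIntegral_mono' hUm.compl fun x hx => ?_
                gcongr
                have h1 := mul_norm_sub_sq_le_deviance (n := n) hfpos x.cells_pos hf1 x.sum_cells
                  (m := ρ * N) (by positivity) (by simpa [hNcast] using hρn)
                have h2 : η ≤ dist x.cells z := not_lt.1 hx
                have h3 : η / 2 ≤ ‖x.cells - f‖ := by
                  have := dist_triangle x.cells f z
                  have := mem_ball.1 hfη
                  rw [← dist_eq_norm]
                  linarith
                have h4 : (η / 2) ^ 2 ≤ ‖x.cells - f‖ ^ 2 := by gcongr
                have h5 := mul_le_mul_of_nonneg_left h4 (show 0 ≤ ρ * N by positivity)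
                have h6 : b * N ≤ S x := by
                  simp only [hbdef, hS]
                  nlinarith
                linarith
            _ ≤ ∫⁻ x, ENNReal.ofReal (Real.exp (-(b / 2 * N))) * π x ∂μ :=
                setLIntegral_le_lintegral _ _
            _ = ENNReal.ofReal (Real.exp (-(b / 2 * N))) * ∫⁻ x, π x ∂μ :=
                lintegral_const_mul _ hπ
            _ ≤ ENNReal.ofReal (Real.exp (-(b / 2 * N))) := mul_le_of_le_one_right' hπ1
    _ = _ := by
        push_cast
        ring

end core

/-! ### The Laplacian quadratic form -/

/-- The quadratic form `vᵀ L v` on centred vectors. -/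
noncomputable def quadForm {K : ℕ} (L : Matrix (Fin K) (Fin K) ℝ) (v : centred K) : ℝ :=
  ∑ i, ∑ j, (v : EuclideanSpace ℝ (Fin K)) i * L i j * (v : EuclideanSpace ℝ (Fin K)) j

section laplacian

variable {K : ℕ} {W : Matrix (Fin K) (Fin K) ℝ}

lemma sum_mul_laplacian_mul (hW : W.IsSymm) (x : Fin K → ℝ) :
    ∑ i, ∑ j, x i * laplacian W i j * x j = (∑ i, ∑ j, W i j * (x i - x j) ^ 2) / 2 := by
  have h1 : ∑ i, ∑ j, x i * laplacian W i j * x j =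
      ∑ i, ∑ j, W i j * x i ^ 2 - ∑ i, ∑ j, x i * W i j * x j := by
    rw [← Finset.sum_sub_distrib]
    refine Finset.sum_congr rfl fun i _ => ?_
    have : ∀ j, x i * laplacian W i j * x j =
        (if i = j then (∑ k, W i k) * x i ^ 2 else 0) - x i * W i j * x j := fun j => by
      rw [laplacian, Matrix.sub_apply, Matrix.diagonal_apply]
      split_ifs with h
      · subst h
        ring
      · ring
    simp only [this, Finset.sum_sub_distrib, Finset.sum_ite_eq, Finset.mem_univ, if_true,
      Finset.sum_mul]
  have h2 : ∑ i, ∑ j, W i j * x j ^ 2 = ∑ i, ∑ j, W i j * x i ^ 2 := by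
    rw [Finset.sum_comm]
    exact Finset.sum_congr rfl fun i _ => Finset.sum_congr rfl fun j _ => by rw [hW.apply]
  have h3 : ∑ i, ∑ j, W i j * (x i - x j) ^ 2 =
      ∑ i, ∑ j, W i j * x i ^ 2 + ∑ i, ∑ j, W i j * x j ^ 2 -
        2 * ∑ i, ∑ j, x i * W i j * x j := by
    simp only [Finset.mul_sum, ← Finset.sum_add_distrib, ← Finset.sum_sub_distrib]
    exact Finset.sum_congr rfl fun i _ => Finset.sum_congr rfl fun j _ => by ring
  rw [h1, h3, h2]
  ring

lemma quadForm_laplacian_nonneg (hW : IsConnectedLabelGraph W) (v : centred K) :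
    0 ≤ quadForm (laplacian W) v := by
  rw [quadForm, sum_mul_laplacian_mul hW.symm]
  exact div_nonneg (Finset.sum_nonneg fun i _ => Finset.sum_nonneg fun j _ =>
    mul_nonneg (hW.nonneg i j) (sq_nonneg _)) zero_le_two

lemma quadForm_laplacian_pos (hW : IsConnectedLabelGraph W) {v : centred K} (hv : v ≠ 0) :
    0 < quadForm (laplacian W) v := by
  refine (quadForm_laplacian_nonneg hW v).lt_of_ne' fun h => hv ?_
  rw [quadForm, sum_mul_laplacian_mul hW.symm, div_eq_zero_iff, or_iff_left two_ne_zero] at h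
  set x := (v : EuclideanSpace ℝ (Fin K)) with hx
  have hnn : ∀ i j, 0 ≤ W i j * (x i - x j) ^ 2 := fun i j =>
    mul_nonneg (hW.nonneg i j) (sq_nonneg _)
  have h0 : ∀ i j, W i j * (x i - x j) ^ 2 = 0 := fun i j => by
    have h1 := (Finset.sum_eq_zero_iff_of_nonneg
      fun i _ => Finset.sum_nonneg fun j _ => hnn i j).1 h i (Finset.mem_univ i)
    exact (Finset.sum_eq_zero_iff_of_nonneg fun j _ => hnn i j).1 h1 j (Finset.mem_univ j)
  have hadj : ∀ i j, W i j ≠ 0 → x i = x j := fun i j hij =>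
    sub_eq_zero.1 (pow_eq_zero_iff two_ne_zero |>.1 ((mul_eq_zero.1 (h0 i j)).resolve_left hij))
  have hall : ∀ i j, x i = x j := fun i j => by
    obtain ⟨p⟩ := hW.connected.preconnected i j
    induction p with
    | nil => rfl
    | cons hab _ ih =>
      refine Eq.trans ?_ ih
      rcases (SimpleGraph.fromRel_adj _ _ _).1 hab with ⟨_, hab | hab⟩
      · exact hadj _ _ hab
      · exact (hadj _ _ hab).symm
  ext i
  have hsum : ∑ j, x j = 0 := v.2
  have hK : (K : ℝ) ≠ 0 := Nat.cast_ne_zero.2 (Fin.pos i).ne'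
  rw [Finset.sum_congr rfl fun j _ => hall j i, Finset.sum_const, Finset.card_univ,
    Fintype.card_fin, nsmul_eq_mul] at hsum
  exact (mul_eq_zero.1 hsum).resolve_left hK

lemma continuous_quadForm (L : Matrix (Fin K) (Fin K) ℝ) : Continuous (quadForm L) := by
  unfold quadForm
  fun_prop

lemma quadForm_smul (L : Matrix (Fin K) (Fin K) ℝ) (c : ℝ) (v : centred K) :
    quadForm L (c • v) = c ^ 2 * quadForm L v := by
  simp only [quadForm, Finset.mul_sum, Submodule.coe_smul, PiLp.smul_apply, smul_eq_mul]
  exact Finset.sum_congr rfl fun i _ => Finset.sum_congr rfl fun j _ => by ring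

lemma exists_mul_sq_norm_le_quadForm (hW : IsConnectedLabelGraph W) :
    ∃ m : ℝ, 0 < m ∧ ∀ v, m * ‖v‖ ^ 2 ≤ quadForm (laplacian W) v := by
  have hscale : ∀ v : centred K, v ≠ 0 → ‖v‖⁻¹ • v ∈ sphere (0 : centred K) 1 := fun v hv => by
    rw [mem_sphere_zero_iff_norm, norm_smul, norm_inv, norm_norm,
      inv_mul_cancel₀ (norm_ne_zero_iff.2 hv)]
  rcases (sphere (0 : centred K) 1).eq_empty_or_nonempty with he | hne
  · refine ⟨1, one_pos, fun v => ?_⟩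
    have : v = 0 := by
      by_contra hv
      exact (he ▸ hscale v hv : _ ∈ (∅ : Set (centred K)))
    simpa [this] using quadForm_laplacian_nonneg hW v
  · obtain ⟨u, hu, hmin⟩ := (isCompact_sphere (0 : centred K) 1).exists_isMinOn hne
      (continuous_quadForm (laplacian W)).continuousOn
    have hu0 : u ≠ 0 := ne_zero_of_mem_unit_sphere (⟨u, hu⟩ : sphere (0 : centred K) 1)
    refine ⟨quadForm (laplacian W) u, quadForm_laplacian_pos hW hu0, fun v => ?_⟩
    rcases eq_or_ne v 0 with rfl | hv
    · simpa using quadForm_laplacian_nonneg hW 0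
    · have h : quadForm (laplacian W) u ≤ quadForm (laplacian W) (‖v‖⁻¹ • v) :=
        hmin (hscale v hv)
      have hv' := norm_pos_iff.2 hv
      rw [quadForm_smul, inv_pow, inv_mul_eq_div, le_div_iff₀ (by positivity)] at h
      exact h

end laplacian

/-! ### The normalising constant of the Gaussian Markov random field -/

lemma integrable_exp_neg_mul_sq_norm_addHaar {V ι : Type*} [NormedAddCommGroup V]
    [InnerProductSpace ℝ V] [FiniteDimensional ℝ V] [MeasurableSpace V] [BorelSpace V]
    [Fintype ι] (e : OrthonormalBasis ι ℝ V) {b : ℝ} (hb : 0 < b) :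
    Integrable (fun v : V => Real.exp (-b * ‖v‖ ^ 2)) e.toBasis.addHaar := by
  rw [e.addHaar_eq_volume]
  refine Integrable.of_integral_ne_zero ?_
  rw [GaussianFourier.integral_rexp_neg_mul_sq_norm hb]
  positivity

section gmrf

variable {K : ℕ} {W : Matrix (Fin K) (Fin K) ℝ}

lemma gmrfWeight_eq (L : Matrix (Fin K) (Fin K) ℝ) (τ : ℝ) (v : centred K) :
    gmrfWeight L τ v = ENNReal.ofReal (Real.exp (-(τ / 2) * quadForm L v)) := rfl

lemma measurable_gmrfWeight (L : Matrix (Fin K) (Fin K) ℝ) :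
    Measurable fun p : ℝ × centred K => gmrfWeight L p.1 p.2 := by
  simp only [gmrfWeight_eq]
  have := (continuous_quadForm L).measurable
  fun_prop

/-- The normalising constant. -/
noncomputable def gmrfConst (L : Matrix (Fin K) (Fin K) ℝ) (τ : ℝ) : ℝ≥0∞ :=
  ∫⁻ w, gmrfWeight L τ w ∂(centredLebesgue K)

lemma measurable_gmrfConst (L : Matrix (Fin K) (Fin K) ℝ) : Measurable (gmrfConst L) :=
  (measurable_gmrfWeight L).lintegral_prod_right'

lemma gmrfDensity_eq (L : Matrix (Fin K) (Fin K) ℝ) (τ : ℝ) (v : centred K) :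
    gmrfDensity L τ v = gmrfWeight L τ v / gmrfConst L τ := rfl

lemma measurable_gmrfDensity (L : Matrix (Fin K) (Fin K) ℝ) :
    Measurable fun p : ℝ × centred K => gmrfDensity L p.1 p.2 := by
  simp only [gmrfDensity_eq]
  exact (measurable_gmrfWeight L).div ((measurable_gmrfConst L).comp measurable_fst)

lemma integrable_exp_neg_quadForm (hW : IsConnectedLabelGraph W) {τ : ℝ} (hτ : 0 < τ) :
    Integrable (fun v => Real.exp (-(τ / 2) * quadForm (laplacian W) v)) (centredLebesgue K) := by
  obtain ⟨m, hm, hle⟩ := exists_mul_sq_norm_le_quadForm hW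
  refine (integrable_exp_neg_mul_sq_norm_addHaar (stdOrthonormalBasis ℝ (centred K))
    (b := τ / 2 * m) (by positivity)).mono' ?_ (ae_of_all _ fun v => ?_)
  · have := continuous_quadForm (laplacian W)
    exact (by fun_prop : Continuous fun v =>
      Real.exp (-(τ / 2) * quadForm (laplacian W) v)).aestronglyMeasurable
  · rw [Real.norm_eq_abs, abs_of_pos (Real.exp_pos _)]
    refine Real.exp_le_exp.2 ?_
    nlinarith [mul_le_mul_of_nonneg_left (hle v) (half_pos hτ).le]

lemma gmrfConst_ne_top (hW : IsConnectedLabelGraph W) {τ : ℝ} (hτ : 0 < τ) :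
    gmrfConst (laplacian W) τ ≠ ∞ := by
  have := (integrable_exp_neg_quadForm hW hτ).lintegral_lt_top
  exact this.ne

lemma gmrfConst_ne_zero (L : Matrix (Fin K) (Fin K) ℝ) (τ : ℝ) : gmrfConst L τ ≠ 0 := by
  have hm : Measurable (gmrfWeight L τ) := (measurable_gmrfWeight L).of_uncurry_left (x := τ)
  refine (lintegral_pos_iff_support hm |>.2 ?_).ne'
  have hsupp : Function.support (gmrfWeight L τ) = univ := eq_univ_of_forall fun v => by
    rw [Function.mem_support, gmrfWeight_eq]
    exact (ENNReal.ofReal_pos.2 (Real.exp_pos _)).ne'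
  rw [hsupp]
  exact Measure.measure_univ_pos.2 (NeZero.ne _)

lemma gmrfConst_eq (L : Matrix (Fin K) (Fin K) ℝ) {τ : ℝ} (hτ : 0 < τ) :
    gmrfConst L τ = ENNReal.ofReal ((√τ ^ Module.finrank ℝ (centred K))⁻¹) * gmrfConst L 1 := by
  have hs := Real.sqrt_pos.2 hτ
  have h : ∀ v : centred K, gmrfWeight L τ v = gmrfWeight L 1 (√τ • v) := fun v => by
    rw [gmrfWeight_eq, gmrfWeight_eq, quadForm_smul, Real.sq_sqrt hτ.le]
    congr 2
    ring
  have hm : Measurable (gmrfWeight L 1) := (measurable_gmrfWeight L).of_uncurry_left (x := 1)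
  rw [gmrfConst, lintegral_congr h, ← lintegral_map hm (measurable_const_smul _),
    Measure.map_addHaar_smul _ hs.ne', lintegral_smul_measure, smul_eq_mul,
    abs_of_pos (by positivity)]
  rfl

lemma inv_gmrfConst_eq (L : Matrix (Fin K) (Fin K) ℝ) {τ : ℝ} (hτ : 0 < τ) :
    (gmrfConst L τ)⁻¹ =
      ENNReal.ofReal (√τ) ^ Module.finrank ℝ (centred K) * (gmrfConst L 1)⁻¹ := by
  have hs := Real.sqrt_pos.2 hτ
  rw [gmrfConst_eq L hτ, ENNReal.mul_inv (Or.inl (by positivity)) (Or.inl ENNReal.ofReal_ne_top),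
    ENNReal.ofReal_inv_of_pos (by positivity), inv_inv, ENNReal.ofReal_pow hs.le]

end gmrf

lemma lintegral_prod_prod_mul {A B A' B' : Type*} [MeasurableSpace A] [MeasurableSpace B]
    [MeasurableSpace A'] [MeasurableSpace B'] (α : Measure A) (β : Measure B) (α' : Measure A')
    (β' : Measure B') [SFinite α] [SFinite β] [SFinite α'] [SFinite β'] {f : A × B → ℝ≥0∞}
    {f' : A' × B' → ℝ≥0∞} {g : B × B' → ℝ≥0∞} (hf : Measurable f) (hf' : Measurable f')
    (hg : Measurable g) :
    ∫⁻ x : (A × B) × (A' × B'), f x.1 * f' x.2 * g (x.1.2, x.2.2)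
        ∂((α.prod β).prod (α'.prod β')) =
      ∫⁻ y, g y * ((∫⁻ a, f (a, y.1) ∂α) * ∫⁻ a, f' (a, y.2) ∂α') ∂(β.prod β') := by
  have hF : Measurable fun b => ∫⁻ a, f (a, b) ∂α := hf.lintegral_prod_left'
  have hF' : Measurable fun b => ∫⁻ a, f' (a, b) ∂α' := hf'.lintegral_prod_left'
  have hinner (p : A × B) : ∫⁻ y, f p * f' y * g (p.2, y.2) ∂(α'.prod β') =
      f p * ∫⁻ b, (∫⁻ a, f' (a, b) ∂α') * g (p.2, b) ∂β' := by
    simp only [mul_assoc]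
    rw [lintegral_const_mul _ (by fun_prop), lintegral_prod_symm' _ (by fun_prop)]
    congr 1
    refine lintegral_congr fun b => ?_
    dsimp only
    rw [lintegral_mul_const _ (by fun_prop)]
  have hH : Measurable fun b => ∫⁻ b', (∫⁻ a, f' (a, b') ∂α') * g (b, b') ∂β' :=
    Measurable.lintegral_prod_right' (f := fun y : B × B' => (∫⁻ a, f' (a, y.2) ∂α') * g y)
      ((hF'.comp measurable_snd).mul hg)
  rw [lintegral_prod _ (by fun_prop)]
  simp only [hinner]
  rw [lintegral_prod_symm' _ (by fun_prop), lintegral_prod _ (by fun_prop)]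
  refine lintegral_congr fun b => ?_
  dsimp only
  rw [lintegral_mul_const _ (by fun_prop), ← lintegral_const_mul _ (by fun_prop)]
  refine lintegral_congr fun b' => ?_
  ring

/-! ### The hyper-priors -/

/-- The properties of a hyper-prior that the analysis uses. -/
structure IsHyperprior (π : Measure ℝ) : Prop where
  prob : IsProbabilityMeasure π
  pos : ∀ᵐ τ ∂π, 0 < τ
  moment : ∀ m : ℕ, ∫⁻ τ, ENNReal.ofReal (√τ) ^ m ∂π ≠ ∞

lemma isHyperprior_dirac {τ : ℝ} (hτ : 0 < τ) : IsHyperprior (Measure.dirac τ) where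
  prob := inferInstance
  pos := by simpa [ae_dirac_eq] using hτ
  moment m := by simp

lemma isHyperprior_gammaMeasure {a b : ℝ} (ha : 0 < a) (hb : 0 < b) :
    IsHyperprior (gammaMeasure a b) := by
  have hmeas : Measurable (gammaPDF a b) := (measurable_gammaPDFReal a b).ennreal_ofReal
  have hpos : ∀ᵐ τ ∂(gammaMeasure a b), 0 < τ := by
    have h0 : ∀ᵐ τ : ℝ, τ ≠ 0 := by simp [ae_iff]
    rw [gammaMeasure, ae_withDensity_iff hmeas]
    filter_upwards [h0] with τ hτ hd
    by_contra hneg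
    exact hd (gammaPDF_of_neg (lt_of_le_of_ne (not_lt.1 hneg) hτ))
  refine ⟨isProbabilityMeasure_gammaMeasure ha hb, hpos, fun m => ?_⟩
  set c := b ^ a / Real.Gamma a / (b ^ (a + m / 2) / Real.Gamma (a + m / 2)) with hc
  have ham : 0 < a + (m : ℝ) / 2 := by positivity
  have hG := Real.Gamma_pos_of_pos ha
  have hG' := Real.Gamma_pos_of_pos ham
  have hc0 : 0 < c := by positivity
  have hle : ∀ᵐ τ : ℝ, gammaPDF a b τ * ENNReal.ofReal (√τ) ^ m =
      ENNReal.ofReal c * gammaPDF (a + m / 2) b τ := by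
    have h0 : ∀ᵐ τ : ℝ, τ ≠ 0 := by simp [ae_iff]
    filter_upwards [h0] with τ hτ
    rcases lt_or_gt_of_ne hτ with hτ | hτ
    · rw [gammaPDF_of_neg hτ, gammaPDF_of_neg hτ, zero_mul, mul_zero]
    · rw [gammaPDF_of_nonneg hτ.le, gammaPDF_of_nonneg hτ.le,
        ← ENNReal.ofReal_pow (Real.sqrt_nonneg _), ← ENNReal.ofReal_mul (by positivity),
        ← ENNReal.ofReal_mul hc0.le]
      congr 1
      have hs : √τ ^ m = τ ^ ((m : ℝ) / 2) := by
        rw [Real.sqrt_eq_rpow, ← Real.rpow_natCast, ← Real.rpow_mul hτ.le]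
        congr 1
        ring
      rw [hs, show a + (m : ℝ) / 2 - 1 = a - 1 + m / 2 by ring, Real.rpow_add hτ, hc]
      field_simp
  rw [gammaMeasure, lintegral_withDensity_eq_lintegral_mul _ hmeas (by fun_prop)]
  simp only [Pi.mul_apply]
  have hmeas' : Measurable (gammaPDF (a + m / 2) b) :=
    (measurable_gammaPDFReal _ b).ennreal_ofReal
  rw [lintegral_congr_ae hle, lintegral_const_mul _ hmeas',
    lintegral_gammaPDF_eq_one ham hb, mul_one]
  exact ENNReal.ofReal_ne_top

lemma IsFixedOrGamma.isHyperprior {π : Measure ℝ} (h : IsFixedOrGamma π) : IsHyperprior π := by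
  obtain ⟨τ, hτ, rfl⟩ | ⟨a, b, ha, hb, rfl⟩ := h
  exacts [isHyperprior_dirac hτ, isHyperprior_gammaMeasure ha hb]

/-! ### The marginal prior density of the log-odds -/

/-- The scale mixture `∫ Z(τ)^{-k} exp (-(τ / 2) s) dπ(τ)`, with `Z(τ)` the normalising
constant. -/
noncomputable def scaleMixture {K : ℕ} (L : Matrix (Fin K) (Fin K) ℝ) (π : Measure ℝ) (k : ℕ)
    (s : ℝ) : ℝ≥0∞ :=
  ∫⁻ τ, (gmrfConst L τ)⁻¹ ^ k * ENNReal.ofReal (Real.exp (-(τ / 2) * s)) ∂π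

/-- The marginal prior density of the log-odds. -/
noncomputable def logOddsDensity {K : ℕ} (L : Matrix (Fin K) (Fin K) ℝ) (πq πC : Measure ℝ)
    (x : LogOdds K) : ℝ≥0∞ :=
  scaleMixture L πq 1 (quadForm L x.1) * scaleMixture L πC K (∑ i, quadForm L (x.2 i))

section

variable {K : ℕ} {W : Matrix (Fin K) (Fin K) ℝ} {L : Matrix (Fin K) (Fin K) ℝ}
  {π πq πC : Measure ℝ}

lemma IsHyperprior.lintegral_inv_gmrfConst_ne_top (hπ : IsHyperprior π) (k : ℕ) :
    ∫⁻ τ, (gmrfConst L τ)⁻¹ ^ k ∂π ≠ ∞ := by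
  have h : ∀ᵐ τ ∂π, (gmrfConst L τ)⁻¹ ^ k =
      ENNReal.ofReal (√τ) ^ (Module.finrank ℝ (centred K) * k) * (gmrfConst L 1)⁻¹ ^ k := by
    filter_upwards [hπ.pos] with τ hτ
    rw [inv_gmrfConst_eq L hτ, mul_pow, pow_mul]
  rw [lintegral_congr_ae h, lintegral_mul_const _ (by fun_prop)]
  exact ENNReal.mul_ne_top (hπ.moment _)
    (ENNReal.pow_ne_top (ENNReal.inv_ne_top.2 (gmrfConst_ne_zero L 1)))

lemma measurable_scaleMixture_integrand (k : ℕ) (s : ℝ) :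
    Measurable fun τ => (gmrfConst L τ)⁻¹ ^ k * ENNReal.ofReal (Real.exp (-(τ / 2) * s)) := by
  have := measurable_gmrfConst L
  fun_prop

lemma scaleMixture_integrand_le {k : ℕ} {s τ : ℝ} (hs : 0 ≤ s) (hτ : 0 < τ) :
    (gmrfConst L τ)⁻¹ ^ k * ENNReal.ofReal (Real.exp (-(τ / 2) * s)) ≤
      (gmrfConst L τ)⁻¹ ^ k := by
  refine mul_le_of_le_one_right' (ENNReal.ofReal_le_one.2 (Real.exp_le_one_iff.2 ?_))
  nlinarith

lemma IsHyperprior.scaleMixture_ne_top (hπ : IsHyperprior π) {k : ℕ} {s : ℝ} (hs : 0 ≤ s) :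
    scaleMixture L π k s ≠ ∞ := by
  refine ne_top_of_le_ne_top (hπ.lintegral_inv_gmrfConst_ne_top (L := L) k)
    (lintegral_mono_ae ?_)
  filter_upwards [hπ.pos] with τ hτ
  exact scaleMixture_integrand_le hs hτ

lemma IsHyperprior.scaleMixture_ne_zero (hπ : IsHyperprior π) (hW : IsConnectedLabelGraph W)
    {k : ℕ} {s : ℝ} : scaleMixture (laplacian W) π k s ≠ 0 := by
  intro h
  rw [scaleMixture, lintegral_eq_zero_iff (measurable_scaleMixture_integrand k s)] at h
  have h1 : ∀ᵐ _τ ∂π, False := by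
    filter_upwards [h, hπ.pos] with τ h0 hτ
    rcases mul_eq_zero.1 h0 with h0 | h0
    · exact gmrfConst_ne_top hW hτ (ENNReal.inv_eq_zero.1 (eq_zero_of_pow_eq_zero h0))
    · exact absurd (ENNReal.ofReal_eq_zero.1 h0) (not_le.2 (Real.exp_pos _))
  have := hπ.prob
  simp at h1
  exact (NeZero.ne π) h1

lemma IsHyperprior.continuous_scaleMixture_comp (hπ : IsHyperprior π) {X : Type*}
    [TopologicalSpace X] [FirstCountableTopology X] {k : ℕ} {s : X → ℝ} (hs : Continuous s)
    (hs0 : ∀ x, 0 ≤ s x) : Continuous fun x => scaleMixture L π k (s x) := by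
  refine continuous_iff_continuousAt.2 fun x => ?_
  refine tendsto_lintegral_filter_of_dominated_convergence (fun τ => (gmrfConst L τ)⁻¹ ^ k)
    (Filter.Eventually.of_forall fun y => measurable_scaleMixture_integrand k (s y))
    (Filter.Eventually.of_forall fun y => ?_) (hπ.lintegral_inv_gmrfConst_ne_top k) ?_
  · filter_upwards [hπ.pos] with τ hτ
    exact scaleMixture_integrand_le (hs0 y) hτ
  · refine ae_of_all _ fun τ => ENNReal.Tendsto.const_mul ?_ (Or.inr ?_)
    · exact (ENNReal.continuous_ofReal.comp (by fun_prop :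
        Continuous fun x => Real.exp (-(τ / 2) * s x))).continuousAt
    · exact ENNReal.pow_ne_top (ENNReal.inv_ne_top.2 (gmrfConst_ne_zero L τ))

lemma continuous_logOddsDensity (hW : IsConnectedLabelGraph W) (hq : IsHyperprior πq)
    (hC : IsHyperprior πC) : Continuous (logOddsDensity (laplacian W) πq πC) := by
  have hQ := continuous_quadForm (laplacian W)
  have h0 : ∀ x : LogOdds K, 0 ≤ ∑ i, quadForm (laplacian W) (x.2 i) := fun x =>
    Finset.sum_nonneg fun _ _ => quadForm_laplacian_nonneg hW _
  have h1 := hq.continuous_scaleMixture_comp (L := laplacian W) (k := 1)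
    (s := fun x : LogOdds K => quadForm (laplacian W) x.1) (by fun_prop)
    fun x => quadForm_laplacian_nonneg hW _
  have h2 := hC.continuous_scaleMixture_comp (L := laplacian W) (k := K)
    (s := fun x : LogOdds K => ∑ i, quadForm (laplacian W) (x.2 i)) (by fun_prop) h0
  refine continuous_iff_continuousAt.2 fun x => ENNReal.Tendsto.mul h1.continuousAt
    (Or.inr (hC.scaleMixture_ne_top (h0 x))) h2.continuousAt
    (Or.inr (hq.scaleMixture_ne_top (quadForm_laplacian_nonneg hW _)))

lemma logOddsDensity_ne_zero (hW : IsConnectedLabelGraph W) (hq : IsHyperprior πq)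
    (hC : IsHyperprior πC) (x : LogOdds K) : logOddsDensity (laplacian W) πq πC x ≠ 0 :=
  mul_ne_zero (hq.scaleMixture_ne_zero hW) (hC.scaleMixture_ne_zero hW)

lemma logOddsDensity_ne_top (hW : IsConnectedLabelGraph W) (hq : IsHyperprior πq)
    (hC : IsHyperprior πC) (x : LogOdds K) : logOddsDensity (laplacian W) πq πC x ≠ ∞ :=
  ENNReal.mul_ne_top (hq.scaleMixture_ne_top (quadForm_laplacian_nonneg hW _))
    (hC.scaleMixture_ne_top (Finset.sum_nonneg fun _ _ => quadForm_laplacian_nonneg hW _))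

lemma gmrfDensity_eq_inv_mul (τ : ℝ) (v : centred K) :
    gmrfDensity L τ v =
      (gmrfConst L τ)⁻¹ ^ 1 * ENNReal.ofReal (Real.exp (-(τ / 2) * quadForm L v)) := by
  rw [gmrfDensity_eq, gmrfWeight_eq, ENNReal.div_eq_inv_mul, pow_one]

lemma prod_gmrfDensity_eq (τ : ℝ) (φ : Fin K → centred K) :
    ∏ i, gmrfDensity L τ (φ i) = (gmrfConst L τ)⁻¹ ^ K *
      ENNReal.ofReal (Real.exp (-(τ / 2) * ∑ i, quadForm L (φ i))) := by
  simp only [gmrfDensity_eq_inv_mul, pow_one]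
  rw [Finset.prod_mul_distrib, Finset.prod_const, Finset.card_univ, Fintype.card_fin,
    Finset.mul_sum, Real.exp_sum, ENNReal.ofReal_prod_of_nonneg fun _ _ => (Real.exp_pos _).le]

lemma lintegral_gmrfDensity_hyper (v : centred K) :
    ∫⁻ τ, gmrfDensity L τ v ∂πq = scaleMixture L πq 1 (quadForm L v) := by
  simp only [gmrfDensity_eq_inv_mul, scaleMixture]

lemma lintegral_prod_gmrfDensity_hyper (φ : Fin K → centred K) :
    ∫⁻ τ, ∏ i, gmrfDensity L τ (φ i) ∂πC = scaleMixture L πC K (∑ i, quadForm L (φ i)) := by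
  simp only [prod_gmrfDensity_eq, scaleMixture]

lemma lintegral_gmrfDensity_le_one (τ : ℝ) :
    ∫⁻ v, gmrfDensity L τ v ∂(centredLebesgue K) ≤ 1 := by
  simp only [gmrfDensity_eq, div_eq_mul_inv]
  rw [lintegral_mul_const _ ((measurable_gmrfWeight L).of_uncurry_left (x := τ))]
  exact ENNReal.div_self_le_one

lemma lintegral_prod_gmrfDensity_le_one (hW : IsConnectedLabelGraph W) {τ : ℝ} (hτ : 0 < τ) :
    ∫⁻ φ : Fin K → centred K, ∏ i, gmrfDensity (laplacian W) τ (φ i)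
      ∂(Measure.pi fun _ => centredLebesgue K) ≤ 1 := by
  have hint := integrable_exp_neg_quadForm hW hτ
  set w : centred K → ℝ := fun v => Real.exp (-(τ / 2) * quadForm (laplacian W) v) with hw
  have hw0 : ∀ v, 0 ≤ w v := fun v => (Real.exp_pos _).le
  have hm : Measurable (gmrfWeight (laplacian W) τ) :=
    (measurable_gmrfWeight (laplacian W)).of_uncurry_left (x := τ)
  have hI : ENNReal.ofReal (∫ v, w v ∂(centredLebesgue K)) = gmrfConst (laplacian W) τ :=
    ofReal_integral_eq_lintegral_ofReal hint (ae_of_all _ hw0)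
  have hpi : ∫⁻ φ : Fin K → centred K, ∏ i, gmrfWeight (laplacian W) τ (φ i)
      ∂(Measure.pi fun _ => centredLebesgue K) = gmrfConst (laplacian W) τ ^ K := by
    have h1 : ∀ φ : Fin K → centred K, ∏ i, gmrfWeight (laplacian W) τ (φ i) =
        ENNReal.ofReal (∏ i, w (φ i)) := fun φ =>
      (ENNReal.ofReal_prod_of_nonneg fun i _ => hw0 (φ i)).symm
    rw [lintegral_congr h1, ← ofReal_integral_eq_lintegral_ofReal
      (Integrable.fintype_prod fun _ => hint)
      (ae_of_all _ fun φ => Finset.prod_nonneg fun _ _ => hw0 _),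
      integral_fintype_prod_eq_pow, Fintype.card_fin,
      ENNReal.ofReal_pow (integral_nonneg hw0), hI]
  simp only [gmrfDensity_eq, div_eq_mul_inv, Finset.prod_mul_distrib, Finset.prod_const,
    Finset.card_univ, Fintype.card_fin]
  have hm' : Measurable fun φ : Fin K → centred K => ∏ i, gmrfWeight (laplacian W) τ (φ i) :=
    Finset.measurable_fun_prod _ fun i _ => hm.comp (measurable_pi_apply i)
  rw [lintegral_mul_const _ hm', hpi, ← mul_pow]
  exact pow_le_one' ENNReal.div_self_le_one K

lemma measurable_prod_gmrfDensity : Measurable fun p : ℝ × (Fin K → centred K) =>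
    ∏ i, gmrfDensity L p.1 (p.2 i) := by
  simp only [prod_gmrfDensity_eq]
  have h1 : Measurable fun p : ℝ × (Fin K → centred K) => (gmrfConst L p.1)⁻¹ ^ K :=
    ((measurable_gmrfConst L).comp measurable_fst).inv.pow_const K
  have h2 : Measurable fun φ : Fin K → centred K => ∑ i, quadForm L (φ i) :=
    Finset.measurable_fun_sum _ fun i _ =>
      (continuous_quadForm L).measurable.comp (measurable_pi_apply i)
  have h3 : Measurable fun p : ℝ × (Fin K → centred K) =>
      Real.exp (-(p.1 / 2) * ∑ i, quadForm L (p.2 i)) :=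
    ((measurable_fst.div_const 2).neg.mul (h2.comp measurable_snd)).exp
  exact h1.mul h3.ennreal_ofReal

lemma measurable_logOddsDensity (hW : IsConnectedLabelGraph W) (hq : IsHyperprior πq)
    (hC : IsHyperprior πC) : Measurable (logOddsDensity (laplacian W) πq πC) :=
  (continuous_logOddsDensity hW hq hC).measurable

lemma lintegral_logOddsDensity_le_one (hW : IsConnectedLabelGraph W) (hq : IsHyperprior πq)
    (hC : IsHyperprior πC) :
    ∫⁻ x, logOddsDensity (laplacian W) πq πC x ∂(logOddsLebesgue K) ≤ 1 := by
  have := hq.prob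
  have := hC.prob
  have h1 : ∫⁻ v, scaleMixture (laplacian W) πq 1 (quadForm (laplacian W) v)
      ∂(centredLebesgue K) ≤ 1 := by
    simp only [← lintegral_gmrfDensity_hyper]
    rw [lintegral_lintegral_swap (f := fun v τ => gmrfDensity (laplacian W) τ v)
      ((measurable_gmrfDensity _).comp measurable_swap).aemeasurable]
    exact (lintegral_mono fun τ => lintegral_gmrfDensity_le_one τ).trans (by simp)
  have h2 : ∫⁻ φ : Fin K → centred K, scaleMixture (laplacian W) πC K
      (∑ i, quadForm (laplacian W) (φ i)) ∂(Measure.pi fun _ => centredLebesgue K) ≤ 1 := by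
    simp only [← lintegral_prod_gmrfDensity_hyper]
    rw [lintegral_lintegral_swap
      (f := fun (φ : Fin K → centred K) τ => ∏ i, gmrfDensity (laplacian W) τ (φ i))
      (measurable_prod_gmrfDensity.comp measurable_swap).aemeasurable]
    refine (lintegral_mono_ae (hC.pos.mono fun τ hτ =>
      lintegral_prod_gmrfDensity_le_one hW hτ)).trans (by simp)
  have hQ := continuous_quadForm (laplacian W)
  have hm1 : Measurable fun v => scaleMixture (laplacian W) πq 1 (quadForm (laplacian W) v) :=
    (hq.continuous_scaleMixture_comp hQ (quadForm_laplacian_nonneg hW)).measurable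
  have hm2 : Measurable fun φ : Fin K → centred K =>
      scaleMixture (laplacian W) πC K (∑ i, quadForm (laplacian W) (φ i)) :=
    (hC.continuous_scaleMixture_comp (by fun_prop) fun φ =>
      Finset.sum_nonneg fun i _ => quadForm_laplacian_nonneg hW _).measurable
  simp only [logOddsDensity, logOddsLebesgue]
  rw [lintegral_prod_mul hm1.aemeasurable hm2.aemeasurable]
  exact mul_le_one' h1 h2

lemma lintegral_prior (hq : IsHyperprior πq)
    (hC : IsHyperprior πC) {g : LogOdds K → ℝ≥0∞} (hg : Measurable g) :
    ∫⁻ x, g (x.1.2, x.2.2) ∂(prior L πq πC) =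
      ∫⁻ x, g x * logOddsDensity L πq πC x ∂(logOddsLebesgue K) := by
  have := hq.prob
  have := hC.prob
  have hD1 : Measurable fun p : ℝ × centred K => gmrfDensity L p.1 p.2 :=
    measurable_gmrfDensity L
  have hD2 := measurable_prod_gmrfDensity (L := L)
  have hD : Measurable fun x : Param K => gmrfDensity L x.1.1 x.1.2 *
      ∏ i, gmrfDensity L x.2.1 (x.2.2 i) :=
    (hD1.comp measurable_fst).mul (hD2.comp measurable_snd)
  have hgm : Measurable fun x : Param K => g (x.1.2, x.2.2) :=
    hg.comp (measurable_fst.snd.prodMk measurable_snd.snd)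
  rw [prior, lintegral_withDensity_eq_lintegral_mul _ hD hgm]
  refine (lintegral_prod_prod_mul πq (centredLebesgue K) πC
    (Measure.pi fun _ : Fin K => centredLebesgue K) hD1 hD2 hg).trans ?_
  rw [logOddsLebesgue]
  refine lintegral_congr fun x => ?_
  rw [logOddsDensity, lintegral_gmrfDensity_hyper, lintegral_prod_gmrfDensity_hyper]

end

/-! ### The algebraic connectivity -/

section lambda2

variable {K : ℕ} {W : Matrix (Fin K) (Fin K) ℝ}

lemma laplacian_apply_self (i : Fin K) :
    laplacian W i i = ∑ j ∈ Finset.univ.erase i, W i j := by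
  rw [laplacian, Matrix.sub_apply, Matrix.diagonal_apply_eq,
    ← Finset.sum_erase_add _ _ (Finset.mem_univ i), add_sub_cancel_right]

lemma IsConnectedLabelGraph.sum_erase_le (hW : IsConnectedLabelGraph W) (i : Fin K) :
    ∑ j ∈ Finset.univ.erase i, W i j ≤ K := by
  calc ∑ j ∈ Finset.univ.erase i, W i j ≤ ∑ _j ∈ Finset.univ.erase i, (1 : ℝ) :=
        Finset.sum_le_sum fun j _ => hW.le_one i j
    _ ≤ ∑ _j : Fin K, (1 : ℝ) :=
        Finset.sum_le_sum_of_subset_of_nonneg (Finset.erase_subset _ _) fun _ _ _ => zero_le_one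
    _ = K := by simp

lemma isHermitian_laplacian (hW : W.IsSymm) : (laplacian W).IsHermitian := by
  ext i j
  simp only [Matrix.conjTranspose_apply, laplacian, Matrix.sub_apply, star_trivial, hW.apply i j]
  rcases eq_or_ne i j with rfl | h
  · rfl
  · rw [Matrix.diagonal_apply_ne _ h, Matrix.diagonal_apply_ne' _ h]

lemma trace_laplacian_pos (hW : IsConnectedLabelGraph W) (hK : 2 ≤ K) :
    0 < (laplacian W).trace := by
  have : Nontrivial (Fin K) := Fin.nontrivial_iff_two_le.2 hK
  have hnn : ∀ i, 0 ≤ laplacian W i i := fun i => by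
    rw [laplacian_apply_self]
    exact Finset.sum_nonneg fun j _ => hW.nonneg i j
  obtain ⟨i, j, hij, h⟩ : ∃ i j, i ≠ j ∧ W i j ≠ 0 := by
    obtain ⟨j, hj⟩ := hW.connected.preconnected.exists_adj_of_nontrivial (⟨0, by omega⟩ : Fin K)
    rcases (SimpleGraph.fromRel_adj _ _ _).1 hj with ⟨hne, h | h⟩
    exacts [⟨_, _, hne, h⟩, ⟨_, _, hne.symm, h⟩]
  refine Finset.sum_pos' (fun i _ => hnn i) ⟨i, Finset.mem_univ i, ?_⟩
  rw [Matrix.diag_apply, laplacian_apply_self]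
  exact Finset.sum_pos' (fun j _ => hW.nonneg i j)
    ⟨j, Finset.mem_erase.2 ⟨hij.symm, Finset.mem_univ j⟩, (hW.nonneg i j).lt_of_ne' h⟩

lemma eigenvalue_laplacian_le (hW : IsConnectedLabelGraph W) {l : ℝ}
    (hl : Module.End.HasEigenvalue (Matrix.toLin' (laplacian W)) l) : l ≤ 2 * K := by
  obtain ⟨i, hi⟩ := eigenvalue_mem_ball hl
  have h1 := (abs_le.1 (mem_closedBall_iff_norm.1 hi)).2
  have h2 : ∑ j ∈ Finset.univ.erase i, ‖laplacian W i j‖ = ∑ j ∈ Finset.univ.erase i, W i j :=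
    Finset.sum_congr rfl fun j hj => by
      rw [laplacian, Matrix.sub_apply, Matrix.diagonal_apply_ne _ (Finset.ne_of_mem_erase hj).symm,
        zero_sub, norm_neg, Real.norm_eq_abs, abs_of_nonneg (hW.nonneg i j)]
  rw [h2, laplacian_apply_self] at h1
  linarith [hW.sum_erase_le i]

lemma lambda2_laplacian_mem (hW : IsConnectedLabelGraph W) (hK : 2 ≤ K) :
    lambda2 (laplacian W) ∈ Ioc (0 : ℝ) (2 * K) := by
  set s := {l : ℝ | 0 < l ∧ Module.End.HasEigenvalue (Matrix.toLin' (laplacian W)) l}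
  have hfin : s.Finite :=
    (Module.End.finite_hasEigenvalue (Matrix.toLin' (laplacian W))).subset fun l hl => hl.2
  have hne : s.Nonempty := by
    have hH := isHermitian_laplacian hW.symm
    have htr := trace_laplacian_pos hW hK
    rw [hH.trace_eq_sum_eigenvalues] at htr
    obtain ⟨i, _, hi⟩ := Finset.exists_lt_of_sum_lt (s := Finset.univ) (f := fun _ => (0 : ℝ))
      (g := fun i => ((hH.eigenvalues i : ℝ) : ℝ)) (by simpa using htr)
    refine ⟨hH.eigenvalues i, hi, ?_⟩
    rw [Module.End.hasEigenvalue_iff_mem_spectrum, Matrix.spectrum_toLin']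
    exact hH.eigenvalues_mem_spectrum_real i
  have hmem : lambda2 (laplacian W) ∈ s := hne.csInf_mem hfin
  exact ⟨hmem.1, eigenvalue_laplacian_le hW hmem.2⟩

end lambda2

/-! ### The posterior -/

section posterior

variable {K : ℕ} {L : Matrix (Fin K) (Fin K) ℝ} {πq πC : Measure ℝ}
  {nS : Fin K → ℕ} {nT : ℕ} {d : Data K}

lemma Param.q_eq (x : Param K) : x.q = LogOdds.q (x.1.2, x.2.2) := rfl

lemma Param.conf_eq (x : Param K) : x.conf = LogOdds.conf (x.1.2, x.2.2) := rfl

lemma likelihood_eq_mul_exp_deviance {f : Option (Fin K) → Fin K → ℝ} (hf : ∀ o j, 0 < f o j)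
    (hfd : ∀ o j, (counts d o j : ℝ) = sizes nS nT o * f o j) (x : LogOdds K) :
    likelihood nS nT x.q x.conf d =
      (∏ o, multinomialProb (sizes nS nT o) (f o) (counts d o)) *
        Real.exp (-deviance (sizes nS nT) f x.cells) := by
  rw [likelihood_eq_prod, deviance, ← Finset.sum_neg_distrib, Real.exp_sum,
    ← Finset.prod_mul_distrib]
  exact Finset.prod_congr rfl fun o _ =>
    multinomialProb_eq_mul_exp_relEnt (x.cells_pos o) (hf o) (hfd o)

lemma multinomialProb_pos {n : ℕ} {p : Fin K → ℝ} {k : Fin K → ℕ} (hp : ∀ j, 0 < p j)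
    (hk : ∑ j, k j = n) : 0 < multinomialProb n p k := by
  rw [multinomialProb, if_pos hk]
  exact mul_pos (Nat.cast_pos.2 (Nat.multinomial_pos _ _))
    (Finset.prod_pos fun j _ => pow_pos (hp j) _)

variable [NeZero K]

lemma measurable_likelihood (nS : Fin K → ℕ) (nT : ℕ) (d : Data K) :
    Measurable fun x : LogOdds K => likelihood nS nT x.q x.conf d := by
  have h : ∀ o, Measurable fun x : LogOdds K =>
      multinomialProb (sizes nS nT o) (x.cells o) (counts d o) := fun o => by
    unfold multinomialProb
    split_ifs
    · exact (Finset.measurable_fun_prod _ fun j _ => ((measurable_pi_apply j).comp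
        ((measurable_pi_apply o).comp measurable_cells)).pow_const _).const_mul _
    · exact measurable_const
  simp only [likelihood_eq_prod]
  exact Finset.measurable_fun_prod _ fun o _ => h o

lemma lintegral_unnormalizedPosterior (hq : IsHyperprior πq) (hC : IsHyperprior πC)
    {M : ℝ} (hM : 0 ≤ M) {S : LogOdds K → ℝ}
    (hlik : ∀ x : LogOdds K, likelihood nS nT x.q x.conf d = M * Real.exp (-S x))
    {h : LogOdds K → ℝ≥0∞} (hh : Measurable h) :
    ∫⁻ x, h (x.1.2, x.2.2) ∂(unnormalizedPosterior L πq πC nS nT d) =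
      ENNReal.ofReal M * ∫⁻ x, ENNReal.ofReal (Real.exp (-S x)) * h x *
        logOddsDensity L πq πC x ∂(logOddsLebesgue K) := by
  have hp : Measurable fun x : Param K => ((x.1.2, x.2.2) : LogOdds K) :=
    measurable_fst.snd.prodMk measurable_snd.snd
  have hl : Measurable fun x : LogOdds K =>
      ENNReal.ofReal (likelihood nS nT x.q x.conf d) * h x :=
    (measurable_likelihood nS nT d).ennreal_ofReal.mul hh
  have hlm : Measurable fun x : Param K => ENNReal.ofReal (likelihood nS nT
      (LogOdds.q (x.1.2, x.2.2)) (LogOdds.conf (x.1.2, x.2.2)) d) :=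
    (measurable_likelihood nS nT d).ennreal_ofReal.comp hp
  have hhm : Measurable fun x : Param K => h (x.1.2, x.2.2) := hh.comp hp
  simp only [unnormalizedPosterior, Param.q_eq, Param.conf_eq]
  rw [lintegral_withDensity_eq_lintegral_mul _ hlm hhm]
  refine (lintegral_prior (L := L) hq hC hl).trans ?_
  rw [← lintegral_const_mul' _ _ ENNReal.ofReal_ne_top]
  refine lintegral_congr fun x => ?_
  rw [hlik, ENNReal.ofReal_mul hM]
  ring

/-- If the deviance has bounded posterior expectation and dominates the squared error of `q i`
about some point, then the posterior is proper and the variance of `q i` is bounded. -/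
lemma isProbabilityMeasure_posterior_and_posteriorVar_le (hq : IsHyperprior πq)
    (hC : IsHyperprior πC) {M : ℝ} (hM : 0 < M) {S : LogOdds K → ℝ}
    (hlik : ∀ x : LogOdds K, likelihood nS nT x.q x.conf d = M * Real.exp (-S x)) {c : ℝ≥0}
    (hT0 : (∫⁻ x, ENNReal.ofReal (Real.exp (-S x)) * logOddsDensity L πq πC x
      ∂(logOddsLebesgue K)) ≠ 0)
    (hTt : (∫⁻ x, ENNReal.ofReal (Real.exp (-S x)) * logOddsDensity L πq πC x
      ∂(logOddsLebesgue K)) ≠ ∞)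
    (hT : ∫⁻ x, ENNReal.ofReal (S x * Real.exp (-S x)) * logOddsDensity L πq πC x
      ∂(logOddsLebesgue K) ≤ c * ∫⁻ x, ENNReal.ofReal (Real.exp (-S x)) *
        logOddsDensity L πq πC x ∂(logOddsLebesgue K))
    {κ : ℝ} (hκ : 0 ≤ κ) {a : Fin K → ℝ}
    (ha : ∀ (x : LogOdds K) i, (x.q i - a i) ^ 2 ≤ κ * S x) :
    IsProbabilityMeasure (posterior L πq πC nS nT d) ∧
      ∀ i, posteriorVar L πq πC nS nT d i ≤ κ * c := by
  set T := ∫⁻ x, ENNReal.ofReal (Real.exp (-S x)) * logOddsDensity L πq πC x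
    ∂(logOddsLebesgue K) with hTdef
  have hM0 : ENNReal.ofReal M ≠ 0 := (ENNReal.ofReal_pos.2 hM).ne'
  have huniv : unnormalizedPosterior L πq πC nS nT d Set.univ = ENNReal.ofReal M * T := by
    rw [← lintegral_one, lintegral_unnormalizedPosterior hq hC hM.le hlik
      (h := fun _ => 1) measurable_const]
    simp only [mul_one, hTdef]
  have hMT0 : ENNReal.ofReal M * T ≠ 0 := mul_ne_zero hM0 hT0
  have hMTt : ENNReal.ofReal M * T ≠ ∞ := ENNReal.mul_ne_top ENNReal.ofReal_ne_top hTt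
  have hprob : IsProbabilityMeasure (posterior L πq πC nS nT d) := ⟨by
    rw [posterior, Measure.smul_apply, huniv, smul_eq_mul, ENNReal.inv_mul_cancel hMT0 hMTt]⟩
  refine ⟨hprob, fun i => ?_⟩
  have hqi : Measurable fun x : LogOdds K => x.q i :=
    (measurable_pi_apply i).comp (LogOdds.contDiff_q.continuous : Continuous
      (LogOdds.q (K := K))).measurable
  have hp : Measurable fun x : Param K => ((x.1.2, x.2.2) : LogOdds K) :=
    measurable_fst.snd.prodMk measurable_snd.snd
  have hqi' : Measurable fun x : Param K => x.q i := hqi.comp hp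
  have hsq : Measurable fun x : LogOdds K => ENNReal.ofReal ((x.q i - a i) ^ 2) :=
    ((hqi.sub_const _).pow_const 2).ennreal_ofReal
  have hle : ∫⁻ x : Param K, ENNReal.ofReal ((x.q i - a i) ^ 2) ∂(posterior L πq πC nS nT d) ≤
      ENNReal.ofReal (κ * c) := by
    have h1 : ∫⁻ x : Param K, ENNReal.ofReal ((x.q i - a i) ^ 2)
        ∂(unnormalizedPosterior L πq πC nS nT d) ≤
        ENNReal.ofReal M * (ENNReal.ofReal (κ * c) * T) := by
      refine (lintegral_unnormalizedPosterior hq hC hM.le hlik hsq).trans_le ?_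
      gcongr
      calc _ ≤ ∫⁻ x, ENNReal.ofReal κ * (ENNReal.ofReal (S x * Real.exp (-S x)) *
            logOddsDensity L πq πC x) ∂(logOddsLebesgue K) := by
            refine lintegral_mono fun x => ?_
            rw [← mul_assoc, ← ENNReal.ofReal_mul hκ, ← ENNReal.ofReal_mul (Real.exp_pos _).le]
            gcongr ENNReal.ofReal ?_ * _
            have := mul_le_mul_of_nonneg_left (ha x i) (Real.exp_pos (-S x)).le
            linarith
        _ = ENNReal.ofReal κ * ∫⁻ x, ENNReal.ofReal (S x * Real.exp (-S x)) *
            logOddsDensity L πq πC x ∂(logOddsLebesgue K) :=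
            lintegral_const_mul' _ _ ENNReal.ofReal_ne_top
        _ ≤ ENNReal.ofReal κ * (c * T) := by gcongr
        _ = ENNReal.ofReal (κ * c) * T := by
            rw [ENNReal.ofReal_mul hκ, ENNReal.ofReal_coe_nnreal, mul_assoc]
    rw [posterior, lintegral_smul_measure, huniv, smul_eq_mul]
    calc _ ≤ (ENNReal.ofReal M * T)⁻¹ * (ENNReal.ofReal M * (ENNReal.ofReal (κ * c) * T)) := by
          gcongr
      _ = (ENNReal.ofReal M * T)⁻¹ * (ENNReal.ofReal M * T) * ENNReal.ofReal (κ * c) := by ring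
      _ = ENNReal.ofReal (κ * c) := by rw [ENNReal.inv_mul_cancel hMT0 hMTt, one_mul]
  rw [posteriorVar, ← variance_sub_const hqi'.aestronglyMeasurable (a i)]
  refine (variance_le_expectation_sq (hqi'.sub_const _).aestronglyMeasurable).trans ?_
  simp only [Pi.pow_apply]
  rw [integral_eq_lintegral_of_nonneg_ae (ae_of_all _ fun x => sq_nonneg _)
    ((hqi'.sub_const _).pow_const 2).aestronglyMeasurable]
  exact ENNReal.toReal_le_of_le_ofReal (by positivity) hle

end posterior

section main

variable {K : ℕ} {q₀ : Fin K → ℝ} {C₀ : Matrix (Fin K) (Fin K) ℝ}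

lemma sum_sizes (nS : Fin K → ℕ) (nT : ℕ) : ∑ o, sizes nS nT o = nT + ∑ i, nS i :=
  Fintype.sum_option _

/-- For data whose frequencies are close to the truth, the posterior is proper and the variance of
the class prior is at most of order `1 / (ρ N)`. -/
lemma exists_posteriorVar_le_of_frequencies [NeZero K] (hq : ∀ i, 0 < q₀ i) (hq1 : ∑ i, q₀ i = 1)
    (hC : ∀ j i, 0 < C₀ j i) (hC1 : ∀ i, ∑ j, C₀ j i = 1) (hdet : C₀.det ≠ 0) :
    ∃ B : ℝ, 0 < B ∧ ∀ W : Matrix (Fin K) (Fin K) ℝ, IsConnectedLabelGraph W →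
      ∀ πq πC : Measure ℝ, IsHyperprior πq → IsHyperprior πC → ∀ ρ : ℝ, 0 < ρ →
      ∃ ε : ℝ, 0 < ε ∧ ∃ N₀ : ℕ, ∀ (N : ℕ) (nS : Fin K → ℕ) (nT : ℕ), N = nT + ∑ i, nS i →
        N₀ ≤ N → (∀ o, ρ * N ≤ sizes nS nT o) → ∀ d ∈ dataSupport nS nT,
        (∀ o j, |counts d o j - sizes nS nT o * cells q₀ C₀ o j| < ε * sizes nS nT o) →
        IsProbabilityMeasure (posterior (laplacian W) πq πC nS nT d) ∧
          ∀ i, posteriorVar (laplacian W) πq πC nS nT d i ≤ B / (ρ * N) := by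
  obtain ⟨c, hcore⟩ := exists_lintegral_deviance_le hq hq1 hC hC1 hdet
  obtain ⟨r, A, hr, hA, hinv⟩ := exists_norm_sub_le_cells hdet
  have hzpos := cells_pos hq hC
  set z := cells q₀ C₀ with hz
  obtain ⟨m, hm, hmz⟩ : ∃ m : ℝ, 0 < m ∧ ∀ o j, m ≤ z o j := by
    have : Nonempty (Option (Fin K) × Fin K) := ⟨none, 0⟩
    obtain ⟨a, ha⟩ := Finite.exists_min fun a : Option (Fin K) × Fin K => z a.1 a.2
    exact ⟨z a.1 a.2, hzpos _ _, fun o j => ha (o, j)⟩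
  refine ⟨4 * A ^ 2 * c + 1, by positivity, fun W hW πq πC hπq hπC ρ hρ => ?_⟩
  obtain ⟨ε, hε, N₀, h⟩ := hcore (logOddsDensity (laplacian W) πq πC)
    (measurable_logOddsDensity hW hπq hπC) (lintegral_logOddsDensity_le_one hW hπq hπC)
    (continuous_logOddsDensity hW hπq hπC).continuousAt (logOddsDensity_ne_zero hW hπq hπC _)
    (logOddsDensity_ne_top hW hπq hπC _) ρ hρ
  refine ⟨min ε (min r m), by positivity, max N₀ 1, fun N nS nT hN hNN hρN d hd hfreq => ?_⟩
  have hN1 : (0 : ℝ) < N := Nat.cast_pos.2 (by omega)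
  have hρN0 : 0 < ρ * N := by positivity
  set n := sizes nS nT with hn
  have hnpos : ∀ o, (0 : ℝ) < n o := fun o => hρN0.trans_le (hρN o)
  set f : Option (Fin K) → Fin K → ℝ := fun o j => counts d o j / n o with hf
  have hfd : ∀ o j, (counts d o j : ℝ) = n o * f o j := fun o j =>
    (mul_div_cancel₀ _ (hnpos o).ne').symm
  have hnear : ∀ o j, |f o j - z o j| < min ε (min r m) := fun o j => by
    have := hfreq o j
    rw [hfd, ← mul_sub, abs_mul, abs_of_pos (hnpos o), mul_comm] at this
    exact lt_of_mul_lt_mul_right this (hnpos o).le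
  have hball : f ∈ ball z (min ε (min r m)) := by
    have hpos : 0 < min ε (min r m) := by positivity
    rw [mem_ball_iff_norm, pi_norm_lt_iff hpos]
    exact fun o => (pi_norm_lt_iff hpos).2 fun j => hnear o j
  have hfpos : ∀ o j, 0 < f o j := pos_of_mem_ball hmz
    (ball_subset_ball ((min_le_right _ _).trans (min_le_right _ _)) hball)
  have hf1 : ∀ o, ∑ j, f o j = 1 := fun o => by
    simp only [hf]
    rw [← Finset.sum_div, div_eq_one_iff_eq (hnpos o).ne']
    exact_mod_cast mem_dataSupport.1 hd o
  have hNsum : ∑ o, n o = N := (sum_sizes nS nT).trans hN.symm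
  have hNsum' : ∑ o, (n o : ℝ) = N := by exact_mod_cast hNsum
  obtain ⟨hT0, hT⟩ := h n (by omega) (by rwa [hNsum']) f
    (ball_subset_ball (min_le_left _ _) hball) hf1
  set M := ∏ o, multinomialProb (n o) (f o) (counts d o)
  have hM : 0 < M := Finset.prod_pos fun o _ =>
    multinomialProb_pos (hfpos o) (mem_dataSupport.1 hd o)
  have hlik := likelihood_eq_mul_exp_deviance (nS := nS) (nT := nT) hfpos hfd
  have hS0 : ∀ x : LogOdds K, 0 ≤ deviance n f x.cells := fun x =>
    deviance_nonneg hfpos x.cells_pos hf1 x.sum_cells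
  have hTt : (∫⁻ x, ENNReal.ofReal (Real.exp (-deviance n f x.cells)) *
      logOddsDensity (laplacian W) πq πC x ∂(logOddsLebesgue K)) ≠ ∞ := by
    refine ne_top_of_le_ne_top ENNReal.one_ne_top
      (le_trans (lintegral_mono fun x => ?_) (lintegral_logOddsDensity_le_one hW hπq hπC))
    refine mul_le_of_le_one_left' (ENNReal.ofReal_le_one.2 (Real.exp_le_one_iff.2 ?_))
    linarith [hS0 x]
  set Cf : Matrix (Fin K) (Fin K) ℝ := Matrix.of fun j i => f (some i) j with hCf
  obtain ⟨hbij, hlip⟩ := hinv Cf fun j i =>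
    ((hnear (some i) j).trans_le ((min_le_right _ _).trans (min_le_left _ _))).le
  obtain ⟨a, ha⟩ := hbij.2 (f none)
  have hcf : cells a Cf = f := by
    funext o
    cases o with
    | none => exact ha
    | some i => rfl
  have hdom : ∀ (x : LogOdds K) i, (x.q i - a i) ^ 2 ≤
      4 * A ^ 2 / (ρ * N) * deviance n f x.cells := fun x i => by
    have h1 := hlip a x.q x.conf x.norm_q_le
    rw [hcf] at h1
    have h2 : |x.q i - a i| ≤ A * ‖x.cells - f‖ := by
      rw [abs_sub_comm, norm_sub_rev]
      exact (norm_le_pi_norm (a - x.q) i).trans h1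
    have h3 := mul_norm_sub_sq_le_deviance (n := n) hfpos x.cells_pos hf1 x.sum_cells hρN0.le hρN
    rw [div_mul_eq_mul_div, le_div_iff₀ hρN0, ← sq_abs]
    calc |x.q i - a i| ^ 2 * (ρ * N) ≤ (A * ‖x.cells - f‖) ^ 2 * (ρ * N) := by gcongr
      _ = A ^ 2 * (ρ * N * ‖x.cells - f‖ ^ 2) := by ring
      _ ≤ A ^ 2 * (4 * deviance n f x.cells) := by gcongr
      _ = _ := by ring
  obtain ⟨hprob, hvar⟩ := isProbabilityMeasure_posterior_and_posteriorVar_le hπq hπC hM hlik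
    hT0 hTt hT (by positivity) hdom
  refine ⟨hprob, fun i => (hvar i).trans ?_⟩
  rw [div_mul_eq_mul_div]
  gcongr
  linarith

end main

end GSBBSE

theorem mainTheorem4 (K : ℕ) (hK : 2 ≤ K)
    (q₀ : Fin K → ℝ) (hq₀ : ∀ i, 0 < q₀ i) (hq₀_sum : ∑ i, q₀ i = 1)
    (C₀ : Matrix (Fin K) (Fin K) ℝ) (hC₀ : ∀ j i, C₀ j i ∈ Set.Ioo (0 : ℝ) 1)
    (hC₀_sum : ∀ i, ∑ j, C₀ j i = 1) (hC₀_det : C₀.det ≠ 0) :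
    ∃ C : ℝ, 0 < C ∧
      ∀ (W : Matrix (Fin K) (Fin K) ℝ), GSBBSE.IsConnectedLabelGraph W →
      ∀ (πq : Measure ℝ), GSBBSE.IsFixedOrGamma πq →
      ∀ (aC bC : ℝ), 0 < aC → 0 < bC →
      ∀ (ρ : ℝ), 0 < ρ → ∀ (δ : ℝ), 0 < δ →
      ∃ N₀ : ℕ, ∀ (N : ℕ) (nS : Fin K → ℕ) (nT : ℕ),
        N = nT + ∑ i, nS i → N₀ ≤ N →
        ρ * N ≤ nT → (∀ i, ρ * N ≤ nS i) →
        1 - δ ≤ (GSBBSE.dataLaw nS nT q₀ C₀).real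
          {d | IsProbabilityMeasure
                (GSBBSE.posterior (GSBBSE.laplacian W) πq (gammaMeasure aC bC) nS nT d) ∧
              ∀ i, GSBBSE.posteriorVar (GSBBSE.laplacian W) πq (gammaMeasure aC bC) nS nT d i
                ≤ C / (ρ * GSBBSE.lambda2 (GSBBSE.laplacian W) * N)} := by
  have : NeZero K := ⟨by omega⟩
  have hC₀_pos : ∀ j i, 0 < C₀ j i := fun j i => (hC₀ j i).1
  have hz := GSBBSE.cells_pos hq₀ hC₀_pos
  have hz1 := GSBBSE.sum_cells hq₀_sum hC₀_sum
  obtain ⟨B, hB, h⟩ := GSBBSE.exists_posteriorVar_le_of_frequencies hq₀ hq₀_sum hC₀_pos hC₀_sum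
    hC₀_det
  refine ⟨B * (2 * K), by positivity, fun W hW πq hπq aC bC haC hbC ρ hρ δ hδ => ?_⟩
  obtain ⟨ε, hε, N₁, hN₁⟩ := h W hW πq (gammaMeasure aC bC) hπq.isHyperprior
    (GSBBSE.isHyperprior_gammaMeasure haC hbC) ρ hρ
  obtain ⟨hl0, hlK⟩ := GSBBSE.lambda2_laplacian_mem hW hK
  set l := GSBBSE.lambda2 (GSBBSE.laplacian W)
  have hε1 : 0 < min ε 1 := by positivity
  have htend : Filter.Tendsto (fun N : ℕ => ((K : ℝ) + 1) * K *
      (2 * Real.exp (-(ρ * N * (min ε 1) ^ 2 / 4)))) Filter.atTop (nhds 0) := by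
    have h1 : Filter.Tendsto (fun N : ℕ => ρ * (min ε 1) ^ 2 / 4 * (N : ℝ)) Filter.atTop
        Filter.atTop := tendsto_natCast_atTop_atTop.const_mul_atTop (by positivity)
    have h2 := ((Real.tendsto_exp_neg_atTop_nhds_zero.comp h1).const_mul 2).const_mul
      (((K : ℝ) + 1) * K)
    simp only [mul_zero] at h2
    refine h2.congr fun N => ?_
    simp only [Function.comp_apply]
    congr 4
    ring
  obtain ⟨N₂, hN₂⟩ := Filter.eventually_atTop.1 (htend.eventually_le_const hδ)
  refine ⟨max (max N₁ N₂) 1, fun N nS nT hN hNN hT hS => ?_⟩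
  have hN0 : (0 : ℝ) < N := Nat.cast_pos.2 (by omega)
  have hsizes : ∀ o, ρ * N ≤ GSBBSE.sizes nS nT o := Option.forall.2 ⟨hT, hS⟩
  have hδN := hN₂ N (by omega)
  refine le_trans (by linarith) (GSBBSE.dataLaw_real_frequencies_ge (fun o j => (hz o j).le) hz1
    hε1 (min_le_right _ _) hsizes _ fun d hd hfreq => ?_)
  obtain ⟨hprob, hvar⟩ := hN₁ N nS nT hN (by omega) hsizes d hd fun o j =>
    (hfreq o j).trans_le (by
      gcongr
      exact min_le_left _ _)
  refine ⟨hprob, fun i => (hvar i).trans ?_⟩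
  rw [div_le_div_iff₀ (by positivity) (by positivity)]
  have : B * (ρ * N) * l ≤ B * (ρ * N) * (2 * K) := by gcongr
  linarith
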